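/- Let $\lambda,\mu>0$, $\rho=\lambda/\mu$, and let $K$ be the capacity of an M/M/1/K queue. Let $\{Q(t)\}_{t\ge 0}$ be its stationary queue-length process, i.e. the càdlàg continuous-time Markov chain on $\{0,1,\dots,K\}$ that moves from $i$ to $i+1$ at rate $\lambda$ (for $i<K$) and from $i$ to $i-1$ at rate $\mu$ (for $i>0$), started from its stationary distribution $$\pi_i=\frac{1-\rho}{1-\rho^{K+1}}\,\rho^i\ \ (\rho\ne 1),\qquad \pi_i=\frac1{K+1}\ \ (\rho=1).$$ Let $D(t)$ be the number of departures during $(0,t]$, i.e. the number of jumps of $Q$ from some $i$ to $i-1$ in $(0,t]$, and let $v(t)=\operatorname{Var}(D(t))$. Then $D(t)$ has a finite second moment for every $t\ge0$, and $$v(t)=\bar v\,t+\bar b_e+o(1)\qquad (t\to\infty),$$ where $$\bar v=\begin{cases}\lambda\,\dfrac{(1+\rho^{K+1})\big(1-(1+2K)\rho^K(1-\rho)-\rho^{2K+1}\big)}{(1-\rho^{K+1})^3}, & \rho\neq 1,\\[2ex] \lambda\Big(\dfrac23-\dfrac{3K+2}{3(K+1)^2}\Big), & \rho=1,\end{cases}$$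 and, for $\rho\ne1$, $$\bar b_e=\rho^{K+1}\left\{\frac{\big(6(1+\rho^2)(1+K)^2-4\rho(1+6K+3K^2)\big)\rho^{K+1}+\rho^2(2+3K+K^2)(1+\rho^{2K})}{(1-\rho)^2(1-\rho^{K+1})^4}-\frac{2\rho(3+2K+K^2)(1+\rho^{2(K+1)})-K(1+K)(1+\rho^{2(K+2)})}{(1-\rho)^2(1-\rho^{K+1})^4}\right\},$$ while for $\rho=1$ $$\bar b_e=\frac{7K^4+28K^3+37K^2+18K}{180\,(K+1)^2}.$$ -/

import Mathlib

open MeasureTheory ProbabilityTheory Filter Topology Asymptotics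
open scoped NNReal Matrix

noncomputable section

/-- `Q` is (a càdlàg version of) a time-homogeneous continuous-time Markov chain on the finite state
space `S` with generator matrix `Λ` and initial distribution `θ`, under the probability `P`:
its paths are almost surely right-continuous with left limits (for the discrete topology), and its
finite-dimensional distributions are those given by the transition function `t ↦ exp (t Λ)`. -/
structure IsMarkovChainWithGenerator {Ω S : Type*} [MeasurableSpace Ω] [Fintype S] [DecidableEq S]
    [MeasurableSpace S] (Λ : Matrix S S ℝ) (θ : S → ℝ) (Q : ℝ≥0 → Ω → S) (P : Measure Ω) :
    Prop where
  measurable : ∀ t, Measurable (Q t)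
  right_continuous : ∀ᵐ ω ∂P, ∀ t : ℝ≥0, ∀ᶠ s in 𝓝[>] t, Q s ω = Q t ω
  left_limits : ∀ᵐ ω ∂P, ∀ t : ℝ≥0, ∃ j : S, ∀ᶠ s in 𝓝[<] t, Q s ω = j
  finite_dimensional : ∀ (n : ℕ) (t : ℕ → ℝ≥0) (i : ℕ → S), Monotone t → t 0 = 0 →
    P.real {ω | ∀ k ≤ n, Q (t k) ω = i k} =
      θ (i 0) * ∏ k ∈ Finset.range n,
        NormedSpace.exp (((t (k + 1) : ℝ) - (t k : ℝ)) • Λ) (i k) (i (k + 1))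

namespace MM1K

/-- The generator of the M/M/1/K queue-length process on `{0, …, K}` with arrival rate `lam` and
service rate `mu`: rate `lam` from `i` to `i + 1`, rate `mu` from `i + 1` to `i`, rows summing
to zero. -/
def generator (lam mu : ℝ) (K : ℕ) : Matrix (Fin (K + 1)) (Fin (K + 1)) ℝ :=
  Matrix.of fun i j =>
    if (j : ℕ) = i + 1 then lam
    else if (i : ℕ) = j + 1 then mu
    else if i = j then -((if (i : ℕ) < K then lam else 0) + (if 0 < (i : ℕ) then mu else 0))
    else 0

/-- The stationary distribution of the M/M/1/K queue-length process. -/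
def stationaryDist (lam mu : ℝ) (K : ℕ) (i : Fin (K + 1)) : ℝ :=
  if lam / mu = 1 then 1 / ((K : ℝ) + 1)
  else (1 - lam / mu) / (1 - (lam / mu) ^ (K + 1)) * (lam / mu) ^ (i : ℕ)

/-- `Q` is the queue-length process of a stationary M/M/1/K queue. -/
def IsStationaryQueue {Ω : Type*} [MeasurableSpace Ω] (lam mu : ℝ) (K : ℕ)
    (Q : ℝ≥0 → Ω → Fin (K + 1)) (P : Measure Ω) : Prop :=
  IsMarkovChainWithGenerator (generator lam mu K) (stationaryDist lam mu K) Q P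

/-- The number of departures during `(0, t]` along the queue-length path `q`: the number of times
`s ∈ (0, t]` at which `q` jumps from some level `j` (its left limit at `s`) down to `j - 1`. -/
def departures {K : ℕ} (q : ℝ≥0 → Fin (K + 1)) (t : ℝ≥0) : ℕ :=
  Set.ncard {s : ℝ≥0 | 0 < s ∧ s ≤ t ∧
    ∃ j : Fin (K + 1), (∀ᶠ r in 𝓝[<] s, q r = j) ∧ (q s : ℕ) + 1 = (j : ℕ)}

/-- The output (departure counting) process `D(t)` of the queue, as a real random variable. -/
def output {Ω : Type*} {K : ℕ} (Q : ℝ≥0 → Ω → Fin (K + 1)) (t : ℝ≥0) (ω : Ω) : ℝ :=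
  (departures (fun s => Q s ω) t : ℝ)

end MM1K

end

/-!
The variance of the output is computed exactly for finite `t`, and its linear asymptotics are then
read off from the ergodicity of the queue.

*From the finite-dimensional laws to the jump counts.* A càdlàg path with values in a finite set has
finitely many jumps in `(0, t]`. Hence the number of down-steps seen on the grid `0, t / n, …, t`
eventually equals the number of departures (`eventually_gridCount_eq`), and for every `n` it is at
most the total number of jumps (`gridCount_le_ncard_jumpTimes`). The finite-dimensional laws give
the first two moments of the grid counts as sums over powers of `exp ((t / n) Λ)`. They show that
the total number of jumps is square integrable (`IsMarkovChainWithGenerator.memLp_ncard_jumpTimes`,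
by Fatou's lemma), so dominated convergence carries the moments over to the departures.

*The limit of the sums.* The double sums approximate `∫₀ᵗ ∫₀ᵘ exp (s Λ) ds du`, but no integral is
needed: it suffices to evaluate them on the vector `w` of departure rates. If `a` is its mean and
`w = a + Λ (Λ y)`, the sums telescope up to the error of `(exp (h Λ) - 1) / h ≈ Λ`
(`tendsto_expDoubleSum_mul`). The outcome is `IsMarkovChainWithGenerator.variance_ncard_jumpTimes`:
the variance is a linear function of `t` plus a term in `exp (t Λ) y - y`.

*Asymptotics.* By reversibility and a Poincaré inequality `exp (t Λ) y` tends to the mean of `y`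
(`MM1K.tendsto_exp_mulVec`). With `π` the stationary distribution and `g = Λ y` the centred solution
of the Poisson equation `Λ g = w - a`, reversibility reduces the slope to `a + 2 λ π_K g_K` and the
intercept to `2 λ π_K (y_K - π y)`, where `π y` is the mean of `y`. The latter equals
`2 λ π_K ∑ π_i u_i g_i`, where `u` solves `Λ u = 1_K / π_K - 1`, because `Λ` is self-adjoint with
respect to `π` (`MM1K.tendsto_variance_output`). Only `g` and `u` are therefore needed in closed
form: for `ρ ≠ 1` both are combinations of `1`, `i` and `ρ ^ (-i)`, for `ρ = 1` they are quadratic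
polynomials in `i`, and the remaining sums are elementary.
-/

/-! ### Jumps of càdlàg paths in a finite state space -/

/-- The times `s ∈ (a, b]` at which the path `q` jumps from its left limit `j` at `s` to a value
`q s` with `R j (q s)`. -/
def jumpTimes {S : Type*} (R : S → S → Prop) (q : ℝ≥0 → S) (a b : ℝ≥0) : Set ℝ≥0 :=
  {s | a < s ∧ s ≤ b ∧ ∃ j : S, (∀ᶠ r in 𝓝[<] s, q r = j) ∧ R j (q s)}

/-- The paths that are right-continuous with left limits for the discrete topology. -/
structure IsCadlag {S : Type*} (q : ℝ≥0 → S) : Prop where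
  right_continuous : ∀ t : ℝ≥0, ∀ᶠ s in 𝓝[>] t, q s = q t
  left_limits : ∀ t : ℝ≥0, ∃ j : S, ∀ᶠ s in 𝓝[<] t, q s = j

section Paths

variable {S : Type*} {q : ℝ≥0 → S} {R : S → S → Prop}

lemma jumpTimes_subset (hR : ∀ i, ¬ R i i) (a b : ℝ≥0) :
    jumpTimes R q a b ⊆ jumpTimes (· ≠ ·) q a b := by
  rintro s ⟨h1, h2, j, h3, h4⟩
  refine ⟨h1, h2, j, h3, ?_⟩
  rintro rfl
  exact hR _ h4

/-- The jump times of a càdlàg path do not accumulate. -/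
lemma IsCadlag.finite_jumpTimes (hq : IsCadlag q) (a b : ℝ≥0) :
    (jumpTimes (· ≠ ·) q a b).Finite := by
  -- Every time has a neighbourhood in which it is the only possible jump time.
  have key : ∀ x : ℝ≥0, ∃ U ∈ 𝓝 x, (jumpTimes (· ≠ ·) q a b ∩ U).Finite := by
    intro x
    obtain ⟨j, hj⟩ := hq.left_limits x
    have h1 : ∀ᶠ y in 𝓝[<] x, ∀ᶠ r in 𝓝 y, q r = j := by
      have := eventually_eventually_nhdsWithin.2 hj
      filter_upwards [this, self_mem_nhdsWithin] with y hy hyx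
      rwa [IsOpen.nhdsWithin_eq isOpen_Iio hyx] at hy
    have h2 : ∀ᶠ y in 𝓝[>] x, ∀ᶠ r in 𝓝 y, q r = q x := by
      have := eventually_eventually_nhdsWithin.2 (hq.right_continuous x)
      filter_upwards [this, self_mem_nhdsWithin] with y hy hyx
      rwa [IsOpen.nhdsWithin_eq isOpen_Ioi hyx] at hy
    have h3 : ∀ᶠ y in 𝓝[≠] x, y ∉ jumpTimes (· ≠ ·) q a b := by
      rw [← Set.Iio_union_Ioi, nhdsWithin_union, eventually_sup]
      constructor
      · filter_upwards [h1] with y hy hyJ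
        obtain ⟨hay, -, i, hi, hne⟩ := hyJ
        have := nhdsLT_neBot_of_exists_lt ⟨a, hay⟩
        obtain ⟨r, hr1, hr2⟩ := (hi.and (hy.filter_mono nhdsWithin_le_nhds)).exists
        exact hne (by rw [← hr1, hr2, hy.self_of_nhds])
      · filter_upwards [h2] with y hy hyJ
        obtain ⟨hay, -, i, hi, hne⟩ := hyJ
        have := nhdsLT_neBot_of_exists_lt ⟨a, hay⟩
        obtain ⟨r, hr1, hr2⟩ := (hi.and (hy.filter_mono nhdsWithin_le_nhds)).exists
        exact hne (by rw [← hr1, hr2, hy.self_of_nhds])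
    rw [eventually_nhdsWithin_iff] at h3
    refine ⟨_, h3, (Set.finite_singleton x).subset ?_⟩
    rintro y ⟨hy1, hy2⟩
    by_contra hne
    exact hy2 hne hy1
  have := isCompact_Icc (a := a) (b := b) |>.induction_on
    (p := fun A => (jumpTimes (· ≠ ·) q a b ∩ A).Finite) (by simp)
    (fun s t hst ht => ht.subset (by gcongr))
    (fun s t hs ht => by rw [Set.inter_union_distrib_left]; exact hs.union ht)
    (fun x _ => by
      obtain ⟨U, hU, hf⟩ := key x
      exact ⟨U, mem_nhdsWithin_of_mem_nhds hU, hf⟩)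
  exact this.subset fun s hs => ⟨hs, hs.1.le, hs.2.1⟩

/-- A càdlàg path without jumps in `(a, b]` is constant on `[a, b]`. -/
lemma IsCadlag.eq_of_jumpTimes_eq_empty (hq : IsCadlag q) {a b : ℝ≥0} (hab : a ≤ b)
    (h : jumpTimes (· ≠ ·) q a b = ∅) : q a = q b := by
  let _ : TopologicalSpace S := ⊥
  have _ : DiscreteTopology S := ⟨rfl⟩
  have hright : ∀ x, Tendsto q (𝓝[>] x) (𝓝 (q x)) := fun x => by
    rw [nhds_discrete, tendsto_pure]; exact hq.right_continuous x
  have hc : ContinuousOn q (Set.Icc a b) := by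
    intro x hx
    rcases hx.1.eq_or_lt with rfl | hax
    · have : ContinuousWithinAt q (Set.Ici a) a := by
        rw [← continuousWithinAt_Ioi_iff_Ici]; exact hright a
      exact this.mono Set.Icc_subset_Ici_self
    · refine ContinuousAt.continuousWithinAt ?_
      rw [continuousAt_iff_continuous_left'_right']
      refine ⟨?_, hright x⟩
      obtain ⟨j, hj⟩ := hq.left_limits x
      have hjx : j = q x := by
        by_contra hne
        have : x ∈ jumpTimes (· ≠ ·) q a b := ⟨hax, hx.2, j, hj, hne⟩
        simp [h] at this
      rw [ContinuousWithinAt, nhds_discrete, tendsto_pure]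
      simpa [hjx] using hj
  exact isPreconnected_Icc.constant hc (Set.left_mem_Icc.2 hab) (Set.right_mem_Icc.2 hab)

lemma jumpTimes_mono (R : S → S → Prop) (q : ℝ≥0 → S) {a a' b b' : ℝ≥0} (ha : a' ≤ a)
    (hb : b ≤ b') : jumpTimes R q a b ⊆ jumpTimes R q a' b' :=
  fun _ hs => ⟨ha.trans_lt hs.1, hs.2.1.trans hb, hs.2.2⟩

/-- If a càdlàg path has at most one jump in `(a, b]`, then the number of jumps of type `R` in
`(a, b]` can be read off from its values at `a` and `b`. -/
lemma IsCadlag.ncard_jumpTimes_of_subsingleton (hq : IsCadlag q) (hR : ∀ i, ¬ R i i)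
    [DecidableRel R] {a b : ℝ≥0} (hab : a ≤ b) (h : (jumpTimes (· ≠ ·) q a b).Subsingleton) :
    (jumpTimes R q a b).ncard = if R (q a) (q b) then 1 else 0 := by
  rcases h.eq_empty_or_singleton with h0 | ⟨s, hs⟩
  · have h1 := hq.eq_of_jumpTimes_eq_empty hab h0
    have : jumpTimes R q a b = ∅ := Set.subset_eq_empty (jumpTimes_subset hR a b) h0
    simp [this, h1, hR]
  · have hsJ : s ∈ jumpTimes (· ≠ ·) q a b := by simp [hs]
    obtain ⟨has, hsb, j, hj, hne⟩ := hsJ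
    have hb : q s = q b := by
      refine hq.eq_of_jumpTimes_eq_empty hsb (Set.eq_empty_of_forall_notMem fun x hx => ?_)
      have := jumpTimes_mono _ q has.le le_rfl hx
      rw [hs] at this
      exact hx.1.ne' this
    have ha : q a = j := by
      have := nhdsLT_neBot_of_exists_lt ⟨a, has⟩
      obtain ⟨r, ⟨hr1, hr3⟩, hr2⟩ := (hj.and (Ico_mem_nhdsLT has)).exists.imp fun r hr =>
        (⟨⟨hr.1, hr.2.2⟩, hr.2.1⟩ : (q r = j ∧ r < s) ∧ a ≤ r)
      rw [← hr1]
      refine hq.eq_of_jumpTimes_eq_empty hr2 (Set.eq_empty_of_forall_notMem fun x hx => ?_)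
      have := jumpTimes_mono _ q le_rfl (hr3.le.trans hsb) hx
      rw [hs] at this
      exact (hx.2.1.trans_lt hr3).ne this
    have hmem : s ∈ jumpTimes R q a b ↔ R (q a) (q b) := by
      rw [ha, ← hb]
      constructor
      · rintro ⟨-, -, j', hj', hR'⟩
        have := nhdsLT_neBot_of_exists_lt ⟨a, has⟩
        obtain ⟨r, h1, h2⟩ := (hj.and hj').exists
        rwa [← h1, h2]
      · exact fun hR' => ⟨has, hsb, j, hj, hR'⟩
    have hsub : jumpTimes R q a b ⊆ {s} := hs ▸ jumpTimes_subset hR a b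
    split_ifs with hif
    · rw [Set.ncard_eq_one]
      exact ⟨s, hsub.antisymm (by simpa using hmem.2 hif)⟩
    · have : jumpTimes R q a b = ∅ := by
        rcases Set.subset_singleton_iff_eq.1 hsub with h' | h'
        · exact h'
        · exact absurd (hmem.1 (by simp [h'])) hif
      simp [this]

lemma IsCadlag.finite_jumpTimes_of_irrefl (hq : IsCadlag q) (hR : ∀ i, ¬ R i i) (a b : ℝ≥0) :
    (jumpTimes R q a b).Finite :=
  (hq.finite_jumpTimes a b).subset (jumpTimes_subset hR a b)

lemma IsCadlag.ncard_jumpTimes_add (hq : IsCadlag q) (hR : ∀ i, ¬ R i i) {a b c : ℝ≥0}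
    (hab : a ≤ b) (hbc : b ≤ c) :
    (jumpTimes R q a c).ncard = (jumpTimes R q a b).ncard + (jumpTimes R q b c).ncard := by
  rw [← Set.ncard_union_eq _ (hq.finite_jumpTimes_of_irrefl hR a b)
    (hq.finite_jumpTimes_of_irrefl hR b c)]
  · congr 1
    ext s
    simp only [jumpTimes, Set.mem_union, Set.mem_ofPred_eq]
    constructor
    · rintro ⟨h1, h2, h3⟩
      rcases le_or_gt s b with h | h
      · exact .inl ⟨h1, h, h3⟩
      · exact .inr ⟨h, h2, h3⟩
    · rintro (⟨h1, h2, h3⟩ | ⟨h1, h2, h3⟩)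
      · exact ⟨h1, h2.trans hbc, h3⟩
      · exact ⟨hab.trans_lt h1, h2, h3⟩
  · rw [Set.disjoint_left]
    exact fun s h1 h2 => h1.2.1.not_gt h2.1

/-- The number of jumps in `(0, t n]` is the sum of those over the intervals of a subdivision. -/
lemma IsCadlag.ncard_jumpTimes_eq_sum (hq : IsCadlag q) (hR : ∀ i, ¬ R i i) {t : ℕ → ℝ≥0}
    (ht : Monotone t) (n : ℕ) :
    (jumpTimes R q (t 0) (t n)).ncard =
      ∑ k ∈ Finset.range n, (jumpTimes R q (t k) (t (k + 1))).ncard := by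
  induction n with
  | zero =>
    have : jumpTimes R q (t 0) (t 0) = ∅ :=
      Set.eq_empty_of_forall_notMem fun s hs => hs.1.not_ge hs.2.1
    simp [this]
  | succ n ih =>
    rw [Finset.sum_range_succ, ← ih]
    exact hq.ncard_jumpTimes_add hR (ht n.zero_le) (ht n.le_succ)

/-- The number of steps of type `R` that the path `q` makes on the grid
`0, t / n, 2 t / n, …, t`. -/
noncomputable def gridCount (R : S → S → Prop) [DecidableRel R] (q : ℝ≥0 → S) (t : ℝ≥0)
    (n : ℕ) : ℕ :=
  ∑ k ∈ Finset.range n, if R (q (k * (t / n))) (q ((k + 1 : ℕ) * (t / n))) then 1 else 0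

lemma cast_gridCount (R : S → S → Prop) [DecidableRel R] (q : ℝ≥0 → S) (t : ℝ≥0) (n : ℕ) :
    (gridCount R q t n : ℝ) = ∑ k ∈ Finset.range n,
      if R (q (k * (t / n))) (q ((k + 1 : ℕ) * (t / n))) then (1 : ℝ) else 0 := by
  rw [gridCount]; push_cast; rfl

lemma gridCount_le (R : S → S → Prop) [DecidableRel R] (q : ℝ≥0 → S) (t : ℝ≥0) (n : ℕ) :
    gridCount R q t n ≤ n := by
  refine (Finset.sum_le_sum (g := fun _ => 1) fun k _ => ?_).trans (by simp)
  split_ifs <;> simp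

lemma monotone_grid (h : ℝ≥0) : Monotone fun k : ℕ => (k : ℝ≥0) * h := fun i j hij => by
  dsimp only; gcongr

/-- Two different values at the ends of a grid interval force a jump inside it. -/
lemma gridCount_le_ncard_jumpTimes (hq : IsCadlag q) (hR : ∀ i, ¬ R i i) [DecidableRel R]
    (t : ℝ≥0) (n : ℕ) : gridCount R q t n ≤ (jumpTimes (· ≠ ·) q 0 t).ncard := by
  rcases Nat.eq_zero_or_pos n with rfl | hn
  · simp [gridCount]
  have h := hq.ncard_jumpTimes_eq_sum (R := (· ≠ ·)) (by simp) (monotone_grid (t / n)) n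
  have hn' : (n : ℝ≥0) ≠ 0 := by positivity
  simp only [Nat.cast_zero, zero_mul, mul_div_cancel₀ t hn'] at h
  rw [h, gridCount]
  refine Finset.sum_le_sum fun k _ => ?_
  split_ifs with hk
  · rw [Nat.one_le_iff_ne_zero]
    intro h0
    rw [Set.ncard_eq_zero (hq.finite_jumpTimes _ _)] at h0
    rw [hq.eq_of_jumpTimes_eq_empty (monotone_grid (t / n) k.le_succ) h0] at hk
    exact hR _ hk
  · exact Nat.zero_le _

/-- On fine enough grids every jump of a càdlàg path is seen. -/
lemma eventually_gridCount_eq (hq : IsCadlag q) (hR : ∀ i, ¬ R i i) [DecidableRel R] (t : ℝ≥0) :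
    ∀ᶠ n in atTop, gridCount R q t n = (jumpTimes R q 0 t).ncard := by
  have hfin := hq.finite_jumpTimes 0 t
  -- `δ` is a lower bound for the distances between different jump times.
  obtain ⟨δ, hδ, hsep⟩ : ∃ δ > (0 : ℝ), ∀ x ∈ jumpTimes (· ≠ ·) q 0 t,
      ∀ y ∈ jumpTimes (· ≠ ·) q 0 t, dist x y < δ → x = y := by
    rcases (jumpTimes (· ≠ ·) q 0 t).subsingleton_or_nontrivial with hs | hs
    · exact ⟨1, one_pos, fun x hx y hy _ => hs hx hy⟩
    · refine ⟨_, hfin.infsep_pos_iff_nontrivial.2 hs, fun x hx y hy hxy => ?_⟩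
      by_contra hne
      exact hxy.not_ge (Set.infsep_le_dist_of_mem hx hy hne)
  have hlim : Tendsto (fun n : ℕ => (t : ℝ) / n) atTop (𝓝 0) :=
    tendsto_const_div_atTop_nhds_zero_nat _
  filter_upwards [hlim.eventually_lt_const hδ, eventually_gt_atTop 0] with n hn hn0
  have h := hq.ncard_jumpTimes_eq_sum hR (monotone_grid (t / n)) n
  have hn' : (n : ℝ≥0) ≠ 0 := by positivity
  simp only [Nat.cast_zero, zero_mul, mul_div_cancel₀ t hn'] at h
  rw [h, gridCount]
  refine Finset.sum_congr rfl fun k hk => ?_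
  have hle := monotone_grid (t / n) k.le_succ
  rw [hq.ncard_jumpTimes_of_subsingleton hR hle]
  have hkt : ((k + 1 : ℕ) : ℝ≥0) * (t / n) ≤ t := by
    calc ((k + 1 : ℕ) : ℝ≥0) * (t / n) ≤ n * (t / n) :=
          monotone_grid (t / n) (Finset.mem_range.1 hk)
      _ = t := mul_div_cancel₀ t hn'
  intro x hx y hy
  refine hsep x (jumpTimes_mono _ q zero_le hkt hx) y (jumpTimes_mono _ q zero_le hkt hy) ?_
  refine lt_of_le_of_lt ?_ hn
  have h1 := NNReal.coe_le_coe.2 hx.1.le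
  have h2 := NNReal.coe_le_coe.2 hx.2.1
  have h3 := NNReal.coe_le_coe.2 hy.1.le
  have h4 := NNReal.coe_le_coe.2 hy.2.1
  push_cast at h1 h2 h3 h4
  rw [NNReal.dist_eq, abs_le]
  constructor <;> linarith

end Paths

/-! ### Vectors fixed by the exponential -/

section Exp

open scoped Matrix.Norms.Operator

variable {S : Type*} [Fintype S] [DecidableEq S]

lemma mul_exp_of_mul_eq_zero {𝔸 : Type*} [NormedRing 𝔸] [NormedAlgebra ℝ 𝔸] [CompleteSpace 𝔸]
    {x a : 𝔸} (h : x * a = 0) : x * NormedSpace.exp a = x := by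
  have h1 := (NormedSpace.exp_series_hasSum_exp' (𝕂 := ℝ) a).mul_left x
  have h2 := hasSum_single (f := fun n : ℕ => x * ((n.factorial : ℝ)⁻¹ • a ^ n)) 0 (by
    intro n hn
    obtain ⟨m, rfl⟩ := Nat.exists_eq_succ_of_ne_zero hn
    simp only [Nat.succ_eq_add_one]
    rw [mul_smul_comm, pow_succ', ← mul_assoc, h, zero_mul, smul_zero])
  simpa using h1.unique h2

lemma exp_mul_of_mul_eq_zero {𝔸 : Type*} [NormedRing 𝔸] [NormedAlgebra ℝ 𝔸] [CompleteSpace 𝔸]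
    {x a : 𝔸} (h : a * x = 0) : NormedSpace.exp a * x = x := by
  have h1 := (NormedSpace.exp_series_hasSum_exp' (𝕂 := ℝ) a).mul_right x
  have h2 := hasSum_single (f := fun n : ℕ => ((n.factorial : ℝ)⁻¹ • a ^ n) * x) 0 (by
    intro n hn
    obtain ⟨m, rfl⟩ := Nat.exists_eq_succ_of_ne_zero hn
    simp only [Nat.succ_eq_add_one]
    rw [smul_mul_assoc, pow_succ, mul_assoc, h, mul_zero, smul_zero])
  simpa using h1.unique h2

lemma vecMul_exp_of_vecMul_eq_zero {θ : S → ℝ} {Λ : Matrix S S ℝ} (h : θ ᵥ* Λ = 0) (s : ℝ) :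
    θ ᵥ* NormedSpace.exp (s • Λ) = θ := by
  have h1 : Matrix.replicateRow S θ * (s • Λ) = 0 := by
    rw [Matrix.mul_smul, ← Matrix.replicateRow_vecMul, h]
    ext; simp
  have h2 := mul_exp_of_mul_eq_zero h1
  rw [← Matrix.replicateRow_vecMul] at h2
  ext i
  exact congrFun (congrFun h2 i) i

end Exp

/-! ### Moments of grid counts of a stationary chain -/

/-- The matrix with the entries of `M` at the pairs of type `R`, and zeros elsewhere. -/
def restrictEntries {S : Type*} (R : S → S → Prop) [DecidableRel R] (M : Matrix S S ℝ) :
    Matrix S S ℝ :=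
  Matrix.of fun i j => if R i j then M i j else 0

lemma sq_sum_range {x : ℕ → ℝ} (n : ℕ) : (∑ k ∈ Finset.range n, x k) ^ 2 =
    ∑ k ∈ Finset.range n, x k ^ 2 +
      2 * ∑ k ∈ Finset.range n, ∑ j ∈ Finset.range k, x j * x k := by
  induction n with
  | zero => simp
  | succ n ih =>
    rw [Finset.sum_range_succ, add_sq, ih]
    simp only [Finset.sum_range_succ _ n, ← Finset.sum_mul]
    ring

section Moments

variable {Ω S : Type*} [MeasurableSpace Ω] [Fintype S] [DecidableEq S] [MeasurableSpace S]
  [MeasurableSingletonClass S] {Λ : Matrix S S ℝ} {θ : S → ℝ} {Q : ℝ≥0 → Ω → S} {P : Measure Ω}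

lemma IsMarkovChainWithGenerator.measurable_step (hQ : IsMarkovChainWithGenerator Λ θ Q P)
    (R : S → S → Prop) [DecidableRel R] (a b : ℝ≥0) :
    Measurable fun ω => if R (Q a ω) (Q b ω) then (1 : ℝ) else 0 :=
  (measurable_of_countable fun x : S × S => if R x.1 x.2 then (1 : ℝ) else 0).comp
    ((hQ.measurable a).prodMk (hQ.measurable b))

variable [IsProbabilityMeasure P]

/-- Joint law of a stationary chain at four times. -/
lemma IsMarkovChainWithGenerator.measureReal_four (hQ : IsMarkovChainWithGenerator Λ θ Q P)
    (hθ : θ ᵥ* Λ = 0) {a b c d : ℝ≥0} (hab : a ≤ b) (hbc : b ≤ c) (hcd : c ≤ d) (i j k l : S) :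
    P.real {ω | Q a ω = i ∧ Q b ω = j ∧ Q c ω = k ∧ Q d ω = l} =
      θ i * NormedSpace.exp (((b : ℝ) - a) • Λ) i j * NormedSpace.exp (((c : ℝ) - b) • Λ) j k *
        NormedSpace.exp (((d : ℝ) - c) • Λ) k l := by
  have hset : {ω | Q a ω = i ∧ Q b ω = j ∧ Q c ω = k ∧ Q d ω = l} =
      ⋃ s ∈ (Finset.univ : Finset S),
        {ω | Q 0 ω = s ∧ Q a ω = i ∧ Q b ω = j ∧ Q c ω = k ∧ Q d ω = l} := by
    ext ω; simp
  have hm : ∀ t s, MeasurableSet {ω | Q t ω = s} := fun t s =>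
    hQ.measurable t (measurableSet_singleton s)
  rw [hset, measureReal_biUnion_finset]
  · have hfd : ∀ s, P.real {ω | Q 0 ω = s ∧ Q a ω = i ∧ Q b ω = j ∧ Q c ω = k ∧ Q d ω = l} =
        θ s * (NormedSpace.exp ((a : ℝ) • Λ) s i * NormedSpace.exp (((b : ℝ) - a) • Λ) i j *
          NormedSpace.exp (((c : ℝ) - b) • Λ) j k * NormedSpace.exp (((d : ℝ) - c) • Λ) k l) := by
      intro s
      have := hQ.finite_dimensional 4
        (fun m => match m with | 0 => 0 | 1 => a | 2 => b | 3 => c | _ => d)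
        (fun m => match m with | 0 => s | 1 => i | 2 => j | 3 => k | _ => l)
        (monotone_nat_of_le_succ fun m => by
          match m with
          | 0 => exact zero_le
          | 1 => exact hab
          | 2 => exact hbc
          | 3 => exact hcd
          | _ + 4 => exact le_rfl) rfl
      simp only [Finset.prod_range_succ, Finset.prod_range_zero, one_mul, NNReal.coe_zero,
        sub_zero] at this
      rw [← this]
      congr 1
      ext ω
      simp only [Set.mem_ofPred_eq]
      constructor
      · rintro ⟨h0, h1, h2, h3, h4⟩ m hm
        interval_cases m <;> assumption
      · intro h
        exact ⟨h 0 (by norm_num), h 1 (by norm_num), h 2 (by norm_num), h 3 (by norm_num),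
          h 4 (by norm_num)⟩
    simp only [hfd]
    have hst := congrFun (vecMul_exp_of_vecMul_eq_zero hθ (a : ℝ)) i
    rw [Matrix.vecMul, dotProduct] at hst
    conv_rhs => rw [← hst]
    simp only [Finset.sum_mul]
    exact Finset.sum_congr rfl fun s _ => by ring
  · intro s _ s' _ hss
    rw [Function.onFun, Set.disjoint_left]
    exact fun ω h1 h2 => hss (h1.1.symm.trans h2.1)
  · intro s _
    exact (hm 0 s).inter ((hm a i).inter ((hm b j).inter ((hm c k).inter (hm d l))))

/-- The probability of a step of type `R` over `(a, b]` and another over `(c, d]`. -/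
lemma IsMarkovChainWithGenerator.integral_step_mul_step (hQ : IsMarkovChainWithGenerator Λ θ Q P)
    (hθ : θ ᵥ* Λ = 0) (R : S → S → Prop) [DecidableRel R] {a b c d : ℝ≥0} (hab : a ≤ b)
    (hbc : b ≤ c) (hcd : c ≤ d) :
    ∫ ω, (if R (Q a ω) (Q b ω) then (1 : ℝ) else 0) * (if R (Q c ω) (Q d ω) then 1 else 0) ∂P =
      θ ⬝ᵥ (restrictEntries R (NormedSpace.exp (((b : ℝ) - a) • Λ)) *ᵥ
        (NormedSpace.exp (((c : ℝ) - b) • Λ) *ᵥ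
          (restrictEntries R (NormedSpace.exp (((d : ℝ) - c) • Λ)) *ᵥ 1))) := by
  have hm := hQ.measurable
  have hX : Measurable fun ω => (Q a ω, Q b ω, Q c ω, Q d ω) :=
    (hm a).prodMk ((hm b).prodMk ((hm c).prodMk (hm d)))
  have hF := integral_map (μ := P) hX.aemeasurable
    (f := fun x : S × S × S × S => (if R x.1 x.2.1 then (1 : ℝ) else 0) *
      (if R x.2.2.1 x.2.2.2 then 1 else 0)) (.of_discrete)
  have := Measure.isProbabilityMeasure_map (μ := P) hX.aemeasurable
  rw [← hF, integral_fintype (.of_finite)]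
  have hμ : ∀ x : S × S × S × S, (Measure.map (fun ω => (Q a ω, Q b ω, Q c ω, Q d ω)) P).real {x} =
      θ x.1 * NormedSpace.exp (((b : ℝ) - a) • Λ) x.1 x.2.1 *
        NormedSpace.exp (((c : ℝ) - b) • Λ) x.2.1 x.2.2.1 *
        NormedSpace.exp (((d : ℝ) - c) • Λ) x.2.2.1 x.2.2.2 := by
    rintro ⟨i, j, k, l⟩
    rw [map_measureReal_apply hX (measurableSet_singleton _),
      ← hQ.measureReal_four hθ hab hbc hcd i j k l]
    congr 1
    ext ω
    simp
  simp only [hμ, Fintype.sum_prod_type, dotProduct, Matrix.mulVec, Finset.mul_sum, smul_eq_mul,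
    restrictEntries, Matrix.of_apply, Pi.one_apply, mul_one]
  refine Finset.sum_congr rfl fun i _ => Finset.sum_congr rfl fun j _ =>
    Finset.sum_congr rfl fun k _ => Finset.sum_congr rfl fun l _ => ?_
  split_ifs <;> ring

lemma IsMarkovChainWithGenerator.integral_step (hQ : IsMarkovChainWithGenerator Λ θ Q P)
    (hθ : θ ᵥ* Λ = 0) (R : S → S → Prop) [DecidableRel R] {a b : ℝ≥0} (hab : a ≤ b) :
    ∫ ω, (if R (Q a ω) (Q b ω) then (1 : ℝ) else 0) ∂P =
      θ ⬝ᵥ (restrictEntries R (NormedSpace.exp (((b : ℝ) - a) • Λ)) *ᵥ 1) := by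
  have hm := hQ.measurable
  have hX : Measurable fun ω => (Q a ω, Q b ω) := (hm a).prodMk (hm b)
  have hF := integral_map (μ := P) hX.aemeasurable
    (f := fun x : S × S => (if R x.1 x.2 then (1 : ℝ) else 0)) (.of_discrete)
  have := Measure.isProbabilityMeasure_map (μ := P) hX.aemeasurable
  rw [← hF, integral_fintype (.of_finite)]
  have hμ : ∀ x : S × S, (Measure.map (fun ω => (Q a ω, Q b ω)) P).real {x} =
      θ x.1 * NormedSpace.exp (((b : ℝ) - a) • Λ) x.1 x.2 := by
    rintro ⟨i, j⟩
    have h4 := hQ.measureReal_four hθ (le_refl a) hab (le_refl b) i i j j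
    simp only [sub_self, zero_smul, NormedSpace.exp_zero, Matrix.one_apply_eq, mul_one] at h4
    rw [map_measureReal_apply hX (measurableSet_singleton _), ← h4]
    congr 1
    ext ω
    simp
  simp only [hμ, Fintype.sum_prod_type, dotProduct, Matrix.mulVec, Finset.mul_sum, smul_eq_mul,
    restrictEntries, Matrix.of_apply, Pi.one_apply, mul_one]
  refine Finset.sum_congr rfl fun i _ => Finset.sum_congr rfl fun j _ => ?_
  split_ifs <;> ring

lemma IsMarkovChainWithGenerator.integrable_step_mul_step
    (hQ : IsMarkovChainWithGenerator Λ θ Q P) (R : S → S → Prop) [DecidableRel R]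
    (a b c d : ℝ≥0) :
    Integrable (fun ω => (if R (Q a ω) (Q b ω) then (1 : ℝ) else 0) *
      (if R (Q c ω) (Q d ω) then 1 else 0)) P := by
  refine .of_bound ((hQ.measurable_step R a b).mul (hQ.measurable_step R c d)).aestronglyMeasurable
    1 (ae_of_all _ fun ω => ?_)
  split_ifs <;> simp

lemma IsMarkovChainWithGenerator.integrable_step
    (hQ : IsMarkovChainWithGenerator Λ θ Q P) (R : S → S → Prop) [DecidableRel R]
    (a b : ℝ≥0) :
    Integrable (fun ω => if R (Q a ω) (Q b ω) then (1 : ℝ) else 0) P := by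
  refine .of_bound (hQ.measurable_step R a b).aestronglyMeasurable
    1 (ae_of_all _ fun ω => ?_)
  split_ifs <;> simp

lemma IsMarkovChainWithGenerator.integral_gridCount (hQ : IsMarkovChainWithGenerator Λ θ Q P)
    (hθ : θ ᵥ* Λ = 0) (R : S → S → Prop) [DecidableRel R] (t : ℝ≥0) (n : ℕ) :
    ∫ ω, (gridCount R (fun s => Q s ω) t n : ℝ) ∂P =
      n * θ ⬝ᵥ (restrictEntries R (NormedSpace.exp (((t : ℝ) / n) • Λ)) *ᵥ 1) := by
  simp only [cast_gridCount]
  rw [integral_finsetSum _ fun k _ => hQ.integrable_step R _ _]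
  have : ∀ k ∈ Finset.range n, ∫ ω, (if R (Q (k * (t / n)) ω) (Q ((k + 1 : ℕ) * (t / n)) ω)
      then (1 : ℝ) else 0) ∂P =
      θ ⬝ᵥ (restrictEntries R (NormedSpace.exp (((t : ℝ) / n) • Λ)) *ᵥ 1) := fun k _ => by
    rw [hQ.integral_step hθ R (monotone_grid (t / n) k.le_succ)]
    push_cast
    rw [show ((k : ℝ) + 1) * (t / n) - k * (t / n) = t / n by ring]
  rw [Finset.sum_congr rfl this, Finset.sum_const, Finset.card_range, nsmul_eq_mul]

/-- The second moment of the number of steps of type `R` on a grid of mesh `h = t / n`: by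
stationarity and the Markov property two steps that are `m` steps apart occur together with
probability `θ A (exp (h Λ)) ^ m A 1`, where `A` is the restriction of `exp (h Λ)` to `R`. -/
lemma IsMarkovChainWithGenerator.integral_gridCount_sq (hQ : IsMarkovChainWithGenerator Λ θ Q P)
    (hθ : θ ᵥ* Λ = 0) (R : S → S → Prop) [DecidableRel R] (t : ℝ≥0) (n : ℕ) :
    ∫ ω, (gridCount R (fun s => Q s ω) t n : ℝ) ^ 2 ∂P =
      n * θ ⬝ᵥ (restrictEntries R (NormedSpace.exp (((t : ℝ) / n) • Λ)) *ᵥ 1) +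
      2 * ∑ k ∈ Finset.range n, ∑ m ∈ Finset.range k,
        θ ⬝ᵥ (restrictEntries R (NormedSpace.exp (((t : ℝ) / n) • Λ)) *ᵥ
          (NormedSpace.exp (((t : ℝ) / n) • Λ) ^ m *ᵥ
          (restrictEntries R (NormedSpace.exp (((t : ℝ) / n) • Λ)) *ᵥ 1))) := by
  have hint : ∀ k j : ℕ, Integrable (fun ω => (if R (Q (j * (t / n)) ω)
      (Q ((j + 1 : ℕ) * (t / n)) ω) then (1 : ℝ) else 0) *
      (if R (Q (k * (t / n)) ω) (Q ((k + 1 : ℕ) * (t / n)) ω) then 1 else 0)) P :=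
    fun k j => hQ.integrable_step_mul_step R _ _ _ _
  have hsq : ∀ ω, (gridCount R (fun s => Q s ω) t n : ℝ) ^ 2 =
      (gridCount R (fun s => Q s ω) t n : ℝ) +
      2 * ∑ k ∈ Finset.range n, ∑ j ∈ Finset.range k, ((if R (Q (j * (t / n)) ω)
      (Q ((j + 1 : ℕ) * (t / n)) ω) then (1 : ℝ) else 0) *
      (if R (Q (k * (t / n)) ω) (Q ((k + 1 : ℕ) * (t / n)) ω) then 1 else 0)) := by
    intro ω
    rw [cast_gridCount, sq_sum_range]
    congr 1
    exact Finset.sum_congr rfl fun k _ => by split_ifs <;> simp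
  simp only [hsq]
  rw [integral_add, hQ.integral_gridCount hθ R, integral_const_mul, integral_finsetSum]
  · congr 2
    refine Finset.sum_congr rfl fun k hk => ?_
    -- The earlier step is indexed by the number `m` of steps between the two.
    rw [integral_finsetSum _ fun j _ => hint k j, ← Finset.sum_range_reflect]
    refine Finset.sum_congr rfl fun m hm => ?_
    have hmk := Finset.mem_range.1 hm
    obtain ⟨j, rfl⟩ : ∃ j, k = j + 1 + m := ⟨k - 1 - m, by omega⟩
    rw [show j + 1 + m - 1 - m = j by omega, hQ.integral_step_mul_step hθ R
      (monotone_grid (t / n) j.le_succ) (monotone_grid (t / n) (Nat.le_add_right (j + 1) m))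
      (monotone_grid (t / n) (j + 1 + m).le_succ), ← Matrix.exp_nsmul]
    have e1 : (((j + 1 : ℕ) * (t / n) : ℝ≥0) : ℝ) - ((j * (t / n) : ℝ≥0) : ℝ) = t / n := by
      push_cast; ring
    have e2 : (((j + 1 + m : ℕ) * (t / n) : ℝ≥0) : ℝ) - (((j + 1 : ℕ) * (t / n) : ℝ≥0) : ℝ)
        = m * (t / n) := by push_cast; ring
    have e3 : (((j + 1 + m + 1 : ℕ) * (t / n) : ℝ≥0) : ℝ) -
        (((j + 1 + m : ℕ) * (t / n) : ℝ≥0) : ℝ) = t / n := by push_cast; ring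
    rw [e1, e2, e3, ← Nat.cast_smul_eq_nsmul ℝ, smul_smul]
  · exact fun k _ => integrable_finsetSum _ fun j _ => hint k j
  · simp only [cast_gridCount]
    exact integrable_finsetSum _ fun k _ => hQ.integrable_step R _ _
  · exact (integrable_finsetSum _ fun k _ => integrable_finsetSum _ fun j _ =>
      hint k j).const_mul 2

end Moments

/-! ### Double sums along the powers of an exponential -/

section NormedAlgebra

variable {𝔸 : Type*} [NormedRing 𝔸] [NormedAlgebra ℝ 𝔸]

/-- The double sum `h ^ 2 ∑_{k < n} ∑_{m < k} exp (h Λ) ^ m`, `h = t / n`, which approximates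
`∫₀ᵗ ∫₀ᵘ exp (s Λ) ds du`. -/
noncomputable def expDoubleSum (Λ : 𝔸) (t : ℝ) (n : ℕ) : 𝔸 :=
  (t / n) ^ 2 • ∑ k ∈ Finset.range n, ∑ m ∈ Finset.range k, NormedSpace.exp ((t / n) • Λ) ^ m

/-- The Riemann sum `h ∑_{m < n} exp (h Λ) ^ m`, `h = t / n`. -/
noncomputable def expSum (Λ : 𝔸) (t : ℝ) (n : ℕ) : 𝔸 :=
  (t / n) • ∑ m ∈ Finset.range n, NormedSpace.exp ((t / n) • Λ) ^ m

/-- The difference quotient `(exp (h Λ) - 1) / h`, `h = t / n`. -/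
noncomputable def expQuotient (Λ : 𝔸) (t : ℝ) (n : ℕ) : 𝔸 :=
  (t / n)⁻¹ • (NormedSpace.exp ((t / n) • Λ) - 1)

variable (Λ : 𝔸) {t : ℝ}

/-- The inner sums telescope. -/
lemma expDoubleSum_mul_expQuotient (ht : 0 < t) {n : ℕ} (hn : 0 < n) :
    expDoubleSum Λ t n * expQuotient Λ t n = expSum Λ t n - t • 1 := by
  have hn' : (0 : ℝ) < n := by exact_mod_cast hn
  have hh : t / n ≠ 0 := (div_pos ht hn').ne'
  rw [expDoubleSum, expSum, expQuotient, smul_mul_smul_comm, Finset.sum_mul]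
  simp only [geom_sum_mul, Finset.sum_sub_distrib, Finset.sum_const, Finset.card_range]
  rw [sq, mul_assoc, mul_inv_cancel₀ hh, mul_one, smul_sub, ← Nat.cast_smul_eq_nsmul ℝ, smul_smul,
    div_mul_cancel₀ _ hn'.ne']

variable [CompleteSpace 𝔸]

lemma tendsto_expQuotient (ht : 0 < t) :
    Tendsto (expQuotient Λ t) atTop (𝓝 Λ) := by
  have h := (hasDerivAt_exp_smul_const (𝕂 := ℝ) Λ 0).tendsto_slope_zero
  simp only [zero_add, zero_smul, NormedSpace.exp_zero, one_mul] at h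
  have hlim : Tendsto (fun n : ℕ => t / n) atTop (𝓝[≠] 0) := by
    rw [tendsto_nhdsWithin_iff]
    refine ⟨tendsto_const_div_atTop_nhds_zero_nat t, ?_⟩
    filter_upwards [eventually_gt_atTop 0] with n hn
    have : (0 : ℝ) < n := by exact_mod_cast hn
    exact (div_pos ht this).ne'
  exact h.comp hlim

lemma exp_smul_pow (s : ℝ) (m : ℕ) :
    NormedSpace.exp (s • Λ) ^ m = NormedSpace.exp ((m * s) • Λ) := by
  let _ : NormedAlgebra ℚ 𝔸 := NormedAlgebra.restrictScalars ℚ ℝ 𝔸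
  rw [← NormedSpace.exp_nsmul, ← Nat.cast_smul_eq_nsmul ℝ, smul_smul]

/-- The sum telescopes. -/
lemma expSum_mul_expQuotient (ht : 0 < t) {n : ℕ} (hn : 0 < n) :
    expSum Λ t n * expQuotient Λ t n = NormedSpace.exp (t • Λ) - 1 := by
  have hn' : (0 : ℝ) < n := by exact_mod_cast hn
  have hh : t / n ≠ 0 := (div_pos ht hn').ne'
  rw [expSum, expQuotient, smul_mul_smul_comm, geom_sum_mul, mul_inv_cancel₀ hh, one_smul,
    exp_smul_pow, mul_div_cancel₀ _ hn'.ne']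

/-- The powers of `exp (h Λ)`, `h = t / n`, up to the `n`-th are uniformly bounded. -/
lemma exists_norm_exp_pow_le (t : ℝ) (ht : 0 < t) :
    ∃ C : ℝ, 0 ≤ C ∧ ∀ n m : ℕ, m ≤ n → ‖NormedSpace.exp ((t / n) • Λ) ^ m‖ ≤ C := by
  have hc : ContinuousOn (fun s : ℝ => NormedSpace.exp (s • Λ)) (Set.Icc 0 t) := fun s _ =>
    (hasDerivAt_exp_smul_const (𝕂 := ℝ) Λ s).continuousAt.continuousWithinAt
  obtain ⟨C, hC⟩ := isCompact_Icc.exists_bound_of_continuousOn hc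
  refine ⟨C, (norm_nonneg _).trans (hC 0 ⟨le_rfl, ht.le⟩), fun n m hmn => ?_⟩
  rw [exp_smul_pow]
  refine hC _ ⟨by positivity, ?_⟩
  rcases Nat.eq_zero_or_pos n with rfl | hn
  · simpa using ht.le
  have hn' : (0 : ℝ) < n := by exact_mod_cast hn
  calc (m : ℝ) * (t / n) ≤ n * (t / n) := by gcongr
    _ = t := mul_div_cancel₀ _ hn'.ne'

lemma isBoundedUnder_expSum (ht : 0 < t) :
    IsBoundedUnder (· ≤ ·) atTop fun n => ‖expSum Λ t n‖ := by
  obtain ⟨C, hC0, hC⟩ := exists_norm_exp_pow_le Λ t ht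
  refine isBoundedUnder_of_eventually_le (a := t * C) ?_
  filter_upwards [eventually_gt_atTop 0] with n hn
  have hn' : (0 : ℝ) < n := by exact_mod_cast hn
  rw [expSum, norm_smul, Real.norm_of_nonneg (by positivity)]
  calc t / n * ‖∑ m ∈ Finset.range n, NormedSpace.exp ((t / n) • Λ) ^ m‖
      ≤ t / n * (n * C) := by
        gcongr
        refine (norm_sum_le_of_le _ fun m hm => hC n m (Finset.mem_range.1 hm).le).trans ?_
        simp
    _ = t * C := by field_simp

lemma isBoundedUnder_expDoubleSum (ht : 0 < t) :
    IsBoundedUnder (· ≤ ·) atTop fun n => ‖expDoubleSum Λ t n‖ := by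
  obtain ⟨C, hC0, hC⟩ := exists_norm_exp_pow_le Λ t ht
  refine isBoundedUnder_of_eventually_le (a := t ^ 2 * C) ?_
  filter_upwards [eventually_gt_atTop 0] with n hn
  have hn' : (0 : ℝ) < n := by exact_mod_cast hn
  rw [expDoubleSum, norm_smul, Real.norm_of_nonneg (by positivity)]
  calc (t / n) ^ 2 * ‖∑ k ∈ Finset.range n, ∑ m ∈ Finset.range k,
        NormedSpace.exp ((t / n) • Λ) ^ m‖
      ≤ (t / n) ^ 2 * (n * (n * C)) := by
        gcongr
        refine (norm_sum_le_of_le (f := fun k => ∑ m ∈ Finset.range k,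
          NormedSpace.exp ((t / n) • Λ) ^ m) (n := fun _ => n * C) _ fun k hk => ?_).trans ?_
        · have hkn := (Finset.mem_range.1 hk).le
          refine (norm_sum_le_of_le _ fun m hm =>
            hC n m ((Finset.mem_range.1 hm).le.trans hkn)).trans ?_
          rw [Finset.sum_const, Finset.card_range, nsmul_eq_mul]
          gcongr
        · simp
    _ = t ^ 2 * C := by field_simp

/-- Limit of the Riemann sums on the range of `Λ`, where `∫₀ᵗ exp (s Λ) Λ ds = exp (t Λ) - 1`. -/
lemma tendsto_expSum_mul (ht : 0 < t) (x : 𝔸) :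
    Tendsto (fun n => expSum Λ t n * (Λ * x)) atTop (𝓝 ((NormedSpace.exp (t • Λ) - 1) * x)) := by
  have h0 : Tendsto (fun n => (Λ - expQuotient Λ t n) * x) atTop (𝓝 0) := by
    simpa using ((tendsto_const_nhds (x := Λ)).sub (tendsto_expQuotient Λ ht)).mul_const x
  have h1 := isBoundedUnder_le_mul_tendsto_zero (isBoundedUnder_expSum Λ ht) h0
  have h2 := h1.const_add ((NormedSpace.exp (t • Λ) - 1) * x)
  rw [add_zero] at h2
  refine h2.congr' ?_
  filter_upwards [eventually_gt_atTop 0] with n hn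
  rw [← expSum_mul_expQuotient Λ ht hn]
  noncomm_ring

/-- Limit of the double sums on the range of `Λ ^ 2`. Replacing the left factor `Λ` by the
difference quotient makes the double sum telescope to a Riemann sum, whose limit on the range of `Λ`
is known. -/
lemma tendsto_expDoubleSum_mul (ht : 0 < t) (x : 𝔸) :
    Tendsto (fun n => expDoubleSum Λ t n * (Λ * (Λ * x))) atTop
      (𝓝 ((NormedSpace.exp (t • Λ) - 1) * x - t • (Λ * x))) := by
  have h0 : Tendsto (fun n => (Λ - expQuotient Λ t n) * (Λ * x)) atTop (𝓝 0) := by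
    simpa using ((tendsto_const_nhds (x := Λ)).sub (tendsto_expQuotient Λ ht)).mul_const (Λ * x)
  have h1 := isBoundedUnder_le_mul_tendsto_zero (isBoundedUnder_expDoubleSum Λ ht) h0
  have h2 := ((tendsto_expSum_mul Λ ht x).sub_const (t • (Λ * x))).add h1
  rw [add_zero] at h2
  refine h2.congr' ?_
  filter_upwards [eventually_gt_atTop 0] with n hn
  have := expDoubleSum_mul_expQuotient Λ ht hn
  have e : expSum Λ t n * (Λ * x) - t • (Λ * x) =
      expDoubleSum Λ t n * expQuotient Λ t n * (Λ * x) := by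
    rw [this, sub_mul, smul_mul_assoc, one_mul]
  rw [e]
  noncomm_ring

variable {Λ}

/-- Limit of the double sums on the kernel of `Λ`. -/
lemma tendsto_expDoubleSum_mul_of_mul_eq_zero {J : 𝔸} (hJ : Λ * J = 0) :
    Tendsto (fun n => expDoubleSum Λ t n * J) atTop (𝓝 ((t ^ 2 / 2) • J)) := by
  have hexp : ∀ (s : ℝ) (m : ℕ), NormedSpace.exp (s • Λ) ^ m * J = J := fun s m => by
    rw [exp_smul_pow]
    exact exp_mul_of_mul_eq_zero (by rw [smul_mul_assoc, hJ, smul_zero])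
  have h1 : Tendsto (fun n : ℕ => t ^ 2 / 2 * (1 - (n : ℝ)⁻¹)) atTop (𝓝 (t ^ 2 / 2)) := by
    simpa using ((tendsto_inv_atTop_nhds_zero_nat (𝕜 := ℝ)).const_sub 1).const_mul (t ^ 2 / 2)
  refine (h1.smul_const J).congr' ?_
  filter_upwards [eventually_gt_atTop 0] with n hn
  have hn' : (n : ℝ) ≠ 0 := by exact_mod_cast hn.ne'
  simp only [expDoubleSum, smul_mul_assoc, Finset.sum_mul, hexp, Finset.sum_const,
    Finset.card_range]
  rw [← Finset.sum_smul, ← Nat.cast_smul_eq_nsmul ℝ, smul_smul]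
  have h2 : ((∑ k ∈ Finset.range n, k : ℕ) : ℝ) * 2 = n * (n - 1) := by
    rw [← Nat.cast_ofNat, ← Nat.cast_mul, Finset.sum_range_id_mul_two, Nat.cast_mul,
      Nat.cast_pred hn]
  congr 1
  rw [eq_div_of_mul_eq two_ne_zero h2]
  field_simp

/-- Limit of the double sums at `a J + Λ ^ 2 x` with `Λ J = 0`, when both factors around the sum
converge. -/
lemma tendsto_mul_expDoubleSum_mul (ht : 0 < t) {B : ℕ → 𝔸} {A J x : 𝔸} {a : ℝ}
    (hJ : Λ * J = 0) (hB : Tendsto B atTop (𝓝 A)) (hA : A * J = a • J + Λ * (Λ * x)) :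
    Tendsto (fun n => B n * (expDoubleSum Λ t n * (B n * J))) atTop
      (𝓝 (A * ((a * t ^ 2 / 2) • J +
        ((NormedSpace.exp (t • Λ) - 1) * x - t • (Λ * x))))) := by
  refine hB.mul ?_
  have h0 : Tendsto (fun n => (B n - A) * J) atTop (𝓝 0) := by
    simpa using (hB.sub_const A).mul_const J
  have h1 := isBoundedUnder_le_mul_tendsto_zero (isBoundedUnder_expDoubleSum Λ ht) h0
  have h2 := (((tendsto_expDoubleSum_mul_of_mul_eq_zero (t := t) hJ).const_smul a).add
    (tendsto_expDoubleSum_mul Λ ht x)).add h1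
  rw [smul_smul, add_zero, ← mul_div_assoc] at h2
  refine h2.congr fun n => ?_
  have e : B n * J = a • J + Λ * (Λ * x) + (B n - A) * J := by rw [← hA]; noncomm_ring
  rw [e, mul_add, mul_add, mul_smul_comm]

lemma isBoundedUnder_mul_expDoubleSum_mul (ht : 0 < t) {B : ℕ → 𝔸} {A : 𝔸} (J : 𝔸)
    (hB : Tendsto B atTop (𝓝 A)) :
    IsBoundedUnder (· ≤ ·) atTop fun n => ‖B n * (expDoubleSum Λ t n * (B n * J))‖ := by
  obtain ⟨b, hb⟩ := hB.norm.isBoundedUnder_le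
  obtain ⟨c, hc⟩ := isBoundedUnder_expDoubleSum Λ ht
  rw [eventually_map] at hb hc
  refine isBoundedUnder_of_eventually_le (a := b * (c * (b * ‖J‖))) ?_
  filter_upwards [hb, hc] with n hbn hcn
  have hb0 := (norm_nonneg _).trans hbn
  have hc0 := (norm_nonneg _).trans hcn
  refine (norm_mul_le _ _).trans (mul_le_mul hbn ((norm_mul_le _ _).trans
    (mul_le_mul hcn ((norm_mul_le _ _).trans ?_) (norm_nonneg _) hc0)) (norm_nonneg _) hb0)
  gcongr

end NormedAlgebra

/-! ### Moments of the number of jumps of a stationary chain -/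

section Limits

open scoped Matrix.Norms.Operator

variable {S : Type*}

lemma continuous_restrictEntries (R : S → S → Prop) [DecidableRel R] :
    Continuous (restrictEntries R : Matrix S S ℝ → Matrix S S ℝ) := by
  refine continuous_pi fun i => continuous_pi fun j => ?_
  by_cases h : R i j
  · simp only [restrictEntries, Matrix.of_apply, h, if_true]
    exact continuous_apply_apply i j
  · simpa [restrictEntries, h] using continuous_const

lemma restrictEntries_smul_sub_one [DecidableEq S] {R : S → S → Prop} [DecidableRel R]
    (hR : ∀ i, ¬ R i i) (c : ℝ) (M : Matrix S S ℝ) :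
    restrictEntries R (c • (M - 1)) = c • restrictEntries R M := by
  ext i j
  by_cases h : R i j
  · have hij : i ≠ j := by rintro rfl; exact hR _ h
    simp [restrictEntries, h, Matrix.one_apply_ne hij]
  · simp [restrictEntries, h]

variable [Fintype S]

lemma continuous_dotProduct_mulVec (θ v : S → ℝ) :
    Continuous fun M : Matrix S S ℝ => θ ⬝ᵥ (M *ᵥ v) := by
  simp only [dotProduct, Matrix.mulVec]
  exact continuous_finsetSum _ fun i _ => continuous_const.mul
    (continuous_finsetSum _ fun j _ => (continuous_apply_apply i j).mul continuous_const)

lemma continuous_vecMul_apply (θ : S → ℝ) (i₀ : S) :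
    Continuous fun M : Matrix S S ℝ => (θ ᵥ* M) i₀ := by
  simp only [dotProduct, Matrix.vecMul]
  exact continuous_finsetSum _ fun i _ => continuous_const.mul (continuous_apply_apply i i₀)

variable [DecidableEq S]

lemma tendsto_restrictEntries_expQuotient (R : S → S → Prop) [DecidableRel R]
    (Λ : Matrix S S ℝ) {t : ℝ} (ht : 0 < t) :
    Tendsto (fun n => restrictEntries R (expQuotient Λ t n)) atTop
      (𝓝 (restrictEntries R Λ)) :=
  ((continuous_restrictEntries R).tendsto _).comp (tendsto_expQuotient Λ ht)

variable {Λ : Matrix S S ℝ} {R : S → S → Prop} [DecidableRel R]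

lemma restrictEntries_exp (hR : ∀ i, ¬ R i i) {t : ℝ} (ht : 0 < t) {n : ℕ} (hn : 0 < n) :
    restrictEntries R (NormedSpace.exp ((t / n) • Λ)) =
      (t / n) • restrictEntries R (expQuotient Λ t n) := by
  have hn' : (0 : ℝ) < n := by exact_mod_cast hn
  rw [expQuotient, restrictEntries_smul_sub_one hR, smul_smul,
    mul_inv_cancel₀ (div_pos ht hn').ne', one_smul]
  -- The norm topology on matrices, used in the normed algebra, is the product topology.
  rfl

/-- Limit of the first moment of the grid counts. -/
lemma tendsto_first_moment (hR : ∀ i, ¬ R i i) (θ : S → ℝ) {t : ℝ} (ht : 0 < t) :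
    Tendsto (fun n : ℕ => n * θ ⬝ᵥ (restrictEntries R (NormedSpace.exp ((t / n) • Λ)) *ᵥ 1))
      atTop (𝓝 (t * θ ⬝ᵥ (restrictEntries R Λ *ᵥ 1))) := by
  have h := ((continuous_dotProduct_mulVec θ 1).tendsto _).comp
    (tendsto_restrictEntries_expQuotient R Λ ht)
  refine (h.const_mul t).congr' ?_
  filter_upwards [eventually_gt_atTop 0] with n hn
  have hn' : (n : ℝ) ≠ 0 := by exact_mod_cast hn.ne'
  rw [restrictEntries_exp hR ht hn, Matrix.smul_mulVec, dotProduct_smul, smul_eq_mul, ← mul_assoc,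
    mul_div_cancel₀ _ hn']
  rfl

/-- The contribution of pairs of different steps to the second moment of the grid counts, written
as an entry of a product of matrices. -/
lemma sum_sum_eq_vecMul (hR : ∀ i, ¬ R i i) (θ : S → ℝ) {t : ℝ} (ht : 0 < t) {n : ℕ}
    (hn : 0 < n) (i₀ : S) :
    ∑ k ∈ Finset.range n, ∑ m ∈ Finset.range k,
        θ ⬝ᵥ (restrictEntries R (NormedSpace.exp ((t / n) • Λ)) *ᵥ
          (NormedSpace.exp ((t / n) • Λ) ^ m *ᵥ
          (restrictEntries R (NormedSpace.exp ((t / n) • Λ)) *ᵥ 1))) =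
      (θ ᵥ* (restrictEntries R (expQuotient Λ t n) * (expDoubleSum Λ t n *
        (restrictEntries R (expQuotient Λ t n) * Matrix.replicateCol S 1)))) i₀ := by
  rw [restrictEntries_exp hR ht hn]
  set B := restrictEntries R (expQuotient Λ t n)
  have h1 : (θ ᵥ* (B * (expDoubleSum Λ t n * (B * Matrix.replicateCol S 1)))) i₀ =
      θ ⬝ᵥ (B *ᵥ (expDoubleSum Λ t n *ᵥ (B *ᵥ 1))) := by
    rw [← Matrix.replicateCol_mulVec, ← Matrix.replicateCol_mulVec, ← Matrix.replicateCol_mulVec]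
    rfl
  rw [h1, expDoubleSum]
  simp only [Matrix.smul_mulVec, Matrix.mulVec_smul, dotProduct_smul, Matrix.sum_mulVec,
    Matrix.mulVec_sum, dotProduct_sum, smul_smul, Finset.smul_sum, sq]
  -- The norm topology on matrices, used in the normed algebra, is the product topology.
  rfl

/-- Limit of the contribution of pairs of different steps to the second moment of the grid counts,
when the rates `A 1` are of the form `a + Λ (Λ y)`. -/
lemma tendsto_second_moment [Nonempty S] (hR : ∀ i, ¬ R i i) (θ : S → ℝ) {t : ℝ} (ht : 0 < t)
    (hΛ : Λ *ᵥ 1 = 0) {a : ℝ} {y : S → ℝ}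
    (hy : restrictEntries R Λ *ᵥ 1 = a • 1 + Λ *ᵥ (Λ *ᵥ y)) :
    Tendsto (fun n : ℕ => ∑ k ∈ Finset.range n, ∑ m ∈ Finset.range k,
        θ ⬝ᵥ (restrictEntries R (NormedSpace.exp ((t / n) • Λ)) *ᵥ
          (NormedSpace.exp ((t / n) • Λ) ^ m *ᵥ
          (restrictEntries R (NormedSpace.exp ((t / n) • Λ)) *ᵥ 1)))) atTop
      (𝓝 (θ ⬝ᵥ (restrictEntries R Λ *ᵥ ((a * t ^ 2 / 2) • 1 +
        ((NormedSpace.exp (t • Λ) *ᵥ y - y) - t • (Λ *ᵥ y)))))) := by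
  obtain ⟨i₀⟩ := ‹Nonempty S›
  have hJ : Λ * Matrix.replicateCol S (1 : S → ℝ) = 0 := by
    rw [← Matrix.replicateCol_mulVec, hΛ, Matrix.replicateCol_zero]
  have hA : restrictEntries R Λ * Matrix.replicateCol S (1 : S → ℝ) =
      a • Matrix.replicateCol S (1 : S → ℝ) + Λ * (Λ * Matrix.replicateCol S y) := by
    simp only [← Matrix.replicateCol_mulVec, ← Matrix.replicateCol_smul,
      ← Matrix.replicateCol_add, hy]
  have h := ((continuous_vecMul_apply θ i₀).tendsto _).comp (tendsto_mul_expDoubleSum_mul ht hJ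
    (tendsto_restrictEntries_expQuotient R Λ ht) hA)
  have hlim : (θ ᵥ* (restrictEntries R Λ * ((a * t ^ 2 / 2) • Matrix.replicateCol S (1 : S → ℝ) +
      ((NormedSpace.exp (t • Λ) - 1) * Matrix.replicateCol S y -
        t • (Λ * Matrix.replicateCol S y))))) i₀ =
      θ ⬝ᵥ (restrictEntries R Λ *ᵥ ((a * t ^ 2 / 2) • 1 +
        ((NormedSpace.exp (t • Λ) *ᵥ y - y) - t • (Λ *ᵥ y)))) := by
    have : (a * t ^ 2 / 2) • Matrix.replicateCol S (1 : S → ℝ) +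
      ((NormedSpace.exp (t • Λ) - 1) * Matrix.replicateCol S y -
        t • (Λ * Matrix.replicateCol S y)) = Matrix.replicateCol S ((a * t ^ 2 / 2) • 1 +
        ((NormedSpace.exp (t • Λ) *ᵥ y - y) - t • (Λ *ᵥ y))) := by
      rw [sub_mul, one_mul, ← Matrix.replicateCol_mulVec, ← Matrix.replicateCol_mulVec]
      rfl
    rw [this, ← Matrix.replicateCol_mulVec]
    rfl
  rw [← hlim]
  refine h.congr' ?_
  filter_upwards [eventually_gt_atTop 0] with n hn
  rw [sum_sum_eq_vecMul hR θ ht hn i₀]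
  rfl

lemma isBoundedUnder_second_moment [Nonempty S] (hR : ∀ i, ¬ R i i) (θ : S → ℝ) {t : ℝ}
    (ht : 0 < t) :
    ∃ c : ℝ, ∀ᶠ n : ℕ in atTop, ∑ k ∈ Finset.range n, ∑ m ∈ Finset.range k,
        θ ⬝ᵥ (restrictEntries R (NormedSpace.exp ((t / n) • Λ)) *ᵥ
          (NormedSpace.exp ((t / n) • Λ) ^ m *ᵥ
          (restrictEntries R (NormedSpace.exp ((t / n) • Λ)) *ᵥ 1))) ≤ c := by
  obtain ⟨i₀⟩ := ‹Nonempty S›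
  obtain ⟨b, hb⟩ := isBoundedUnder_mul_expDoubleSum_mul (Λ := Λ) ht
    (Matrix.replicateCol S (1 : S → ℝ)) (tendsto_restrictEntries_expQuotient R Λ ht)
  rw [eventually_map] at hb
  refine ⟨(∑ i, |θ i|) * b, ?_⟩
  filter_upwards [hb, eventually_gt_atTop 0] with n hbn hn
  rw [sum_sum_eq_vecMul hR θ ht hn i₀]
  set X := restrictEntries R (expQuotient Λ t n) * (expDoubleSum Λ t n *
        (restrictEntries R (expQuotient Λ t n) * Matrix.replicateCol S 1))
  have hX : ∀ i j, |X i j| ≤ ‖X‖ := fun i j => by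
    have h1 : ‖X i j‖₊ ≤ ∑ j, ‖X i j‖₊ :=
      Finset.single_le_sum (f := fun j => ‖X i j‖₊) (fun _ _ => zero_le) (Finset.mem_univ j)
    have h2 : ∑ j, ‖X i j‖₊ ≤ ‖X‖₊ := by
      rw [Matrix.linfty_opNNNorm_def]
      exact Finset.le_sup (f := fun i => ∑ j, ‖X i j‖₊) (Finset.mem_univ i)
    exact h1.trans h2
  rw [Matrix.vecMul, dotProduct, Finset.sum_mul]
  refine Finset.sum_le_sum fun i _ => ?_
  calc θ i * X i i₀ ≤ |θ i * X i i₀| := le_abs_self _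
    _ = |θ i| * |X i i₀| := abs_mul _ _
    _ ≤ |θ i| * b := by gcongr; exact (hX i i₀).trans hbn

end Limits

section JumpMoments

variable {Ω S : Type*} [MeasurableSpace Ω] [Fintype S] [DecidableEq S] [MeasurableSpace S]
  {Λ : Matrix S S ℝ} {θ : S → ℝ} {Q : ℝ≥0 → Ω → S} {P : Measure Ω}

lemma IsMarkovChainWithGenerator.ae_isCadlag (hQ : IsMarkovChainWithGenerator Λ θ Q P) :
    ∀ᵐ ω ∂P, IsCadlag fun s => Q s ω := by
  filter_upwards [hQ.right_continuous, hQ.left_limits] with ω h1 h2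
  exact ⟨h1, h2⟩

lemma IsMarkovChainWithGenerator.ae_norm_gridCount_le (hQ : IsMarkovChainWithGenerator Λ θ Q P)
    {R : S → S → Prop} [DecidableRel R] (hR : ∀ i, ¬ R i i) (t : ℝ≥0) (n : ℕ) :
    ∀ᵐ ω ∂P, ‖(gridCount R (fun s => Q s ω) t n : ℝ)‖ ≤
      ((jumpTimes (· ≠ ·) (fun s => Q s ω) 0 t).ncard : ℝ) := by
  filter_upwards [hQ.ae_isCadlag] with ω hω
  rw [Real.norm_of_nonneg (by positivity)]
  exact_mod_cast gridCount_le_ncard_jumpTimes hω hR t n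

lemma IsMarkovChainWithGenerator.tendsto_gridCount (hQ : IsMarkovChainWithGenerator Λ θ Q P)
    {R : S → S → Prop} [DecidableRel R] (hR : ∀ i, ¬ R i i) (t : ℝ≥0) :
    ∀ᵐ ω ∂P, Tendsto (fun n => (gridCount R (fun s => Q s ω) t n : ℝ)) atTop
      (𝓝 ((jumpTimes R (fun s => Q s ω) 0 t).ncard : ℝ)) := by
  filter_upwards [hQ.ae_isCadlag] with ω hω
  exact tendsto_const_nhds.congr'
    ((eventually_gridCount_eq hω hR t).mono fun n hn => by simp only [hn])

variable [MeasurableSingletonClass S]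

lemma IsMarkovChainWithGenerator.measurable_gridCount (hQ : IsMarkovChainWithGenerator Λ θ Q P)
    (R : S → S → Prop) [DecidableRel R] (t : ℝ≥0) (n : ℕ) :
    Measurable fun ω => (gridCount R (fun s => Q s ω) t n : ℝ) := by
  simp only [cast_gridCount]
  exact Finset.measurable_sum _ fun k _ => hQ.measurable_step R _ _

variable [IsProbabilityMeasure P]

/-- The number of jumps of a stationary finite chain is square integrable, by Fatou's lemma. -/
lemma IsMarkovChainWithGenerator.memLp_ncard_jumpTimes [Nonempty S]
    (hQ : IsMarkovChainWithGenerator Λ θ Q P) (hθ : θ ᵥ* Λ = 0)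
    {R : S → S → Prop} [DecidableRel R] (hR : ∀ i, ¬ R i i) {t : ℝ≥0} (ht : 0 < t) :
    MemLp (fun ω => ((jumpTimes R (fun s => Q s ω) 0 t).ncard : ℝ)) 2 P := by
  have ht' : (0 : ℝ) < t := ht
  have hlim := hQ.tendsto_gridCount hR t
  have hm := fun n => (hQ.measurable_gridCount R t n).aestronglyMeasurable (μ := P)
  have hmeas := aestronglyMeasurable_of_tendsto_ae atTop hm hlim
  rw [memLp_two_iff_integrable_sq hmeas, ← memLp_one_iff_integrable]
  refine ⟨hmeas.pow 2, ?_⟩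
  obtain ⟨c, hc⟩ := isBoundedUnder_second_moment (Λ := Λ) hR θ ht'
  obtain ⟨d, hd⟩ := (tendsto_first_moment (Λ := Λ) hR θ ht').isBoundedUnder_le
  rw [eventually_map] at hd
  refine lt_of_le_of_lt (Lp.eLpNorm_le_of_ae_tendsto (u := atTop) (C := ENNReal.ofReal (d + 2 * c))
    (f := fun n ω => (gridCount R (fun s => Q s ω) t n : ℝ) ^ 2) ?_ (fun n => (hm n).pow 2) ?_)
    ENNReal.ofReal_lt_top
  · filter_upwards [hc, hd] with n hcn hdn
    have hint : Integrable (fun ω => (gridCount R (fun s => Q s ω) t n : ℝ) ^ 2) P := by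
      refine .of_bound ((hm n).pow 2) ((n : ℝ) ^ 2) (ae_of_all _ fun ω => ?_)
      rw [Real.norm_of_nonneg (by positivity)]
      have : (gridCount R (fun s => Q s ω) t n : ℝ) ≤ n := by
        exact_mod_cast gridCount_le R _ t n
      gcongr
    rw [eLpNorm_one_eq_lintegral_enorm, ← ofReal_integral_norm_eq_lintegral_enorm hint]
    refine ENNReal.ofReal_le_ofReal ?_
    simp only [Real.norm_of_nonneg (sq_nonneg _)]
    rw [hQ.integral_gridCount_sq hθ R]
    linarith
  · filter_upwards [hlim] with ω hω
    exact hω.pow 2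

/-- The grid counts of any type of jump are dominated by the total number of jumps, hence their
moments converge. -/
lemma IsMarkovChainWithGenerator.integral_ncard_jumpTimes [Nonempty S]
    (hQ : IsMarkovChainWithGenerator Λ θ Q P) (hθ : θ ᵥ* Λ = 0)
    {R : S → S → Prop} [DecidableRel R] (hR : ∀ i, ¬ R i i) {t : ℝ≥0} (ht : 0 < t) :
    ∫ ω, ((jumpTimes R (fun s => Q s ω) 0 t).ncard : ℝ) ∂P =
      t * θ ⬝ᵥ (restrictEntries R Λ *ᵥ 1) := by
  have hJ := hQ.memLp_ncard_jumpTimes hθ (R := (· ≠ ·)) (by simp) ht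
  have h := tendsto_integral_of_dominated_convergence _
    (fun n => (hQ.measurable_gridCount R t n).aestronglyMeasurable)
    (hJ.integrable (by norm_num)) (hQ.ae_norm_gridCount_le hR t) (hQ.tendsto_gridCount hR t)
  simp only [hQ.integral_gridCount hθ R] at h
  exact tendsto_nhds_unique h (tendsto_first_moment hR θ ht)

/-- The second moment, again by dominated convergence of the grid counts. -/
lemma IsMarkovChainWithGenerator.integral_ncard_jumpTimes_sq [Nonempty S]
    (hQ : IsMarkovChainWithGenerator Λ θ Q P) (hθ : θ ᵥ* Λ = 0) (hΛ : Λ *ᵥ 1 = 0)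
    {R : S → S → Prop} [DecidableRel R] (hR : ∀ i, ¬ R i i) {t : ℝ≥0} (ht : 0 < t)
    {a : ℝ} {y : S → ℝ} (hy : restrictEntries R Λ *ᵥ 1 = a • 1 + Λ *ᵥ (Λ *ᵥ y)) :
    ∫ ω, ((jumpTimes R (fun s => Q s ω) 0 t).ncard : ℝ) ^ 2 ∂P =
      t * θ ⬝ᵥ (restrictEntries R Λ *ᵥ 1) +
      2 * θ ⬝ᵥ (restrictEntries R Λ *ᵥ ((a * (t : ℝ) ^ 2 / 2) • 1 +
        ((NormedSpace.exp ((t : ℝ) • Λ) *ᵥ y - y) - (t : ℝ) • (Λ *ᵥ y)))) := by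
  have hJ := hQ.memLp_ncard_jumpTimes hθ (R := (· ≠ ·)) (by simp) ht
  have h := tendsto_integral_of_dominated_convergence
    (F := fun n ω => (gridCount R (fun s => Q s ω) t n : ℝ) ^ 2) _
    (fun n => ((hQ.measurable_gridCount R t n).pow_const 2).aestronglyMeasurable)
    hJ.integrable_sq
    (fun n => by
      filter_upwards [hQ.ae_norm_gridCount_le hR t n] with ω hω
      rw [norm_pow]
      gcongr)
    (by
      filter_upwards [hQ.tendsto_gridCount hR t] with ω hω
      exact hω.pow 2)
  simp only [hQ.integral_gridCount_sq hθ R] at h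
  exact tendsto_nhds_unique h ((tendsto_first_moment hR θ ht).add
    ((tendsto_second_moment hR θ ht hΛ hy).const_mul 2))

/-- The variance of the number of jumps of type `R` in `(0, t]`, where `A` is the restriction of the
generator to `R`. The vector `A 1` of the rates of such jumps has mean `a`, and `Λ y` solves the
Poisson equation `Λ (Λ y) = A 1 - a`. The contributions of order `t ^ 2` cancel. -/
lemma IsMarkovChainWithGenerator.variance_ncard_jumpTimes [Nonempty S]
    (hQ : IsMarkovChainWithGenerator Λ θ Q P) (hθ : θ ᵥ* Λ = 0) (hΛ : Λ *ᵥ 1 = 0)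
    (hθ1 : θ ⬝ᵥ 1 = 1) {R : S → S → Prop} [DecidableRel R] (hR : ∀ i, ¬ R i i) {t : ℝ≥0}
    (ht : 0 < t) {a : ℝ} {y : S → ℝ}
    (hy : restrictEntries R Λ *ᵥ 1 = a • 1 + Λ *ᵥ (Λ *ᵥ y)) :
    Var[fun ω => ((jumpTimes R (fun s => Q s ω) 0 t).ncard : ℝ); P] =
      t * (a - 2 * (θ ᵥ* restrictEntries R Λ) ⬝ᵥ (Λ *ᵥ y)) +
        2 * (θ ᵥ* restrictEntries R Λ) ⬝ᵥ (NormedSpace.exp ((t : ℝ) • Λ) *ᵥ y - y) := by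
  have ha : θ ⬝ᵥ (restrictEntries R Λ *ᵥ 1) = a := by
    rw [hy, dotProduct_add, dotProduct_smul, hθ1, Matrix.dotProduct_mulVec, hθ]
    simp
  rw [variance_eq_sub (hQ.memLp_ncard_jumpTimes hθ hR ht), hQ.integral_ncard_jumpTimes hθ hR ht]
  have h2 := hQ.integral_ncard_jumpTimes_sq hθ hΛ hR ht hy
  simp only [Pi.pow_apply]
  rw [h2, ha, Matrix.mulVec_add, Matrix.mulVec_smul, dotProduct_add, dotProduct_smul, ha,
    Matrix.mulVec_sub, Matrix.mulVec_smul, dotProduct_sub, dotProduct_smul,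
    Matrix.dotProduct_mulVec, Matrix.dotProduct_mulVec]
  simp only [smul_eq_mul]
  ring

end JumpMoments

namespace MM1K

/-! ### Birth–death operators and reversibility -/

/-- The generator of the M/M/1/K queue, acting on functions of the queue length. -/
def birthDeath (lam mu : ℝ) (K : ℕ) (G : ℕ → ℝ) (i : ℕ) : ℝ :=
  (if i < K then lam * (G (i + 1) - G i) else 0) + (if 0 < i then mu * (G (i - 1) - G i) else 0)

/-- The stationary distribution, as the normalized geometric weights on `{0, …, K}`. -/
noncomputable def weight (rho : ℝ) (K i : ℕ) : ℝ := rho ^ i / ∑ j ∈ Finset.range (K + 1), rho ^ j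

section Weight

variable {lam mu : ℝ} {K : ℕ}

lemma stationaryDist_eq_weight (lam mu : ℝ) (K : ℕ) (i : Fin (K + 1)) :
    stationaryDist lam mu K i = weight (lam / mu) K i := by
  rw [stationaryDist, weight]
  split_ifs with h
  · simp [h]
  · have h1 : lam / mu - 1 ≠ 0 := sub_ne_zero.2 h
    rw [geom_sum_eq h, div_div_eq_mul_div, ← neg_sub, ← neg_sub ((lam / mu) ^ (K + 1)) 1,
      neg_div_neg_eq]
    ring

lemma sum_pow_pos {rho : ℝ} (hrho : 0 < rho) (K : ℕ) :
    0 < ∑ j ∈ Finset.range (K + 1), rho ^ j :=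
  Finset.sum_pos (fun j _ => pow_pos hrho j) (by simp)

lemma weight_pos {rho : ℝ} (hrho : 0 < rho) (K i : ℕ) : 0 < weight rho K i :=
  div_pos (pow_pos hrho i) (sum_pow_pos hrho K)

lemma sum_weight {rho : ℝ} (hrho : 0 < rho) (K : ℕ) :
    ∑ i ∈ Finset.range (K + 1), weight rho K i = 1 := by
  simp only [weight]
  rw [← Finset.sum_div, div_self (sum_pow_pos hrho K).ne']

/-- Detailed balance. -/
lemma weight_succ (hmu : 0 < mu) (K i : ℕ) :
    mu * weight (lam / mu) K (i + 1) = lam * weight (lam / mu) K i := by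
  rw [weight, weight, pow_succ]
  field_simp

variable {p : ℕ → ℝ}

/-- Summation by parts for a reversible birth–death operator. -/
lemma sum_mul_birthDeath (hp : ∀ i, mu * p (i + 1) = lam * p i) (F G : ℕ → ℝ) :
    ∑ i ∈ Finset.range (K + 1), p i * (F i * birthDeath lam mu K G i) =
      -∑ i ∈ Finset.range K, lam * p i * ((F (i + 1) - F i) * (G (i + 1) - G i)) := by
  simp only [birthDeath, mul_add, Finset.sum_add_distrib]
  have h1 : ∑ i ∈ Finset.range (K + 1),
      p i * (F i * (if i < K then lam * (G (i + 1) - G i) else 0)) =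
      ∑ i ∈ Finset.range K, p i * (F i * (lam * (G (i + 1) - G i))) := by
    rw [Finset.sum_range_succ]
    simp only [lt_irrefl, if_false, mul_zero, add_zero]
    exact Finset.sum_congr rfl fun i hi => by rw [if_pos (Finset.mem_range.1 hi)]
  have h2 : ∑ i ∈ Finset.range (K + 1),
      p i * (F i * (if 0 < i then mu * (G (i - 1) - G i) else 0)) =
      ∑ i ∈ Finset.range K, mu * p (i + 1) * (F (i + 1) * (G i - G (i + 1))) := by
    rw [Finset.sum_range_succ']
    simp only [lt_irrefl, if_false, mul_zero, add_zero, Nat.succ_pos, if_true,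
      Nat.add_sub_cancel]
    exact Finset.sum_congr rfl fun i _ => by ring
  rw [h1, h2, ← Finset.sum_add_distrib, ← Finset.sum_neg_distrib]
  exact Finset.sum_congr rfl fun i _ => by rw [hp]; ring

lemma sum_birthDeath (hp : ∀ i, mu * p (i + 1) = lam * p i) (G : ℕ → ℝ) :
    ∑ i ∈ Finset.range (K + 1), p i * birthDeath lam mu K G i = 0 := by
  simpa using sum_mul_birthDeath (K := K) hp (fun _ => 1) G

/-- A reversible birth–death operator is self-adjoint. -/
lemma sum_birthDeath_comm (hp : ∀ i, mu * p (i + 1) = lam * p i) (F G : ℕ → ℝ) :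
    ∑ i ∈ Finset.range (K + 1), p i * (F i * birthDeath lam mu K G i) =
      ∑ i ∈ Finset.range (K + 1), p i * (birthDeath lam mu K F i * G i) := by
  simp only [mul_comm (birthDeath lam mu K F _)]
  rw [sum_mul_birthDeath hp, sum_mul_birthDeath hp]
  congr 1
  exact Finset.sum_congr rfl fun i _ => by ring

/-- The Poisson equation for a centred function has a solution: the flux through the edge
`(i, i + 1)` is the total mass of the right-hand side on `{0, …, i}`. -/
lemma exists_birthDeath_eq (hlam : 0 < lam) (hp0 : ∀ i, 0 < p i)
    (hp : ∀ i, mu * p (i + 1) = lam * p i) {g : ℕ → ℝ}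
    (hg : ∑ i ∈ Finset.range (K + 1), p i * g i = 0) :
    ∃ y : ℕ → ℝ, ∀ i ≤ K, birthDeath lam mu K y i = g i := by
  let T : ℕ → ℝ := fun i => ∑ l ∈ Finset.range (i + 1), p l * g l
  let y : ℕ → ℝ := fun i => ∑ j ∈ Finset.range i, T j / (lam * p j)
  have hy : ∀ i, y (i + 1) - y i = T i / (lam * p i) := fun i => by
    simp [y, Finset.sum_range_succ]
  have hup : ∀ i, lam * (y (i + 1) - y i) = T i / p i := fun i => by
    have := hp0 i
    rw [hy]; field_simp
  have hdown : ∀ i, mu * (y i - y (i + 1)) = -(T i / p (i + 1)) := fun i => by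
    have := hp0 (i + 1)
    rw [← neg_sub, hy, ← hp i]
    have hmu : mu ≠ 0 := by
      rintro rfl
      have := hp i
      rw [zero_mul] at this
      exact (mul_pos hlam (hp0 i)).ne this
    field_simp
  have hT : ∀ i, T (i + 1) = T i + p (i + 1) * g (i + 1) := fun i => by
    simp [T, Finset.sum_range_succ]
  refine ⟨y, fun i hi => ?_⟩
  -- At `i = K` the total mass `T K` vanishes, so that the boundary needs no separate formula.
  have hiK : (if i < K then lam * (y (i + 1) - y i) else 0) = T i / p i := by
    split_ifs with h
    · exact hup i
    · obtain rfl : i = K := by omega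
      simp [T, hg]
  have := (hp0 i).ne'
  rw [birthDeath, hiK]
  cases i with
  | zero => simp [T]; field_simp
  | succ i =>
    rw [if_pos i.succ_pos, Nat.add_sub_cancel, hdown, hT]
    field_simp
    ring

/-- Poincaré inequality: the Dirichlet form of the chain controls the variance. -/
lemma exists_poincare (hlam : 0 < lam) (hp0 : ∀ i, 0 < p i)
    (hp1 : ∑ i ∈ Finset.range (K + 1), p i = 1) :
    ∃ c > 0, ∀ G : ℕ → ℝ, ∑ i ∈ Finset.range (K + 1), p i * G i = 0 →
      c * ∑ i ∈ Finset.range (K + 1), p i * G i ^ 2 ≤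
        ∑ i ∈ Finset.range K, lam * p i * (G (i + 1) - G i) ^ 2 := by
  obtain ⟨k, -, hk⟩ := Finset.exists_min_image (Finset.range (K + 1)) p ⟨0, by simp⟩
  refine ⟨lam * p k / (K + 1), by have := hp0 k; positivity, fun G hG => ?_⟩
  set D := ∑ i ∈ Finset.range K, (G (i + 1) - G i) ^ 2 with hD
  have hD0 : 0 ≤ D := Finset.sum_nonneg fun i _ => sq_nonneg _
  have h1 : ∀ i ∈ Finset.range (K + 1), (G i - G 0) ^ 2 ≤ K * D := fun i hi => by
    have hiK : i ≤ K := Nat.lt_succ_iff.1 (Finset.mem_range.1 hi)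
    have hiK' : (i : ℝ) ≤ K := by exact_mod_cast hiK
    rw [← Finset.sum_range_sub]
    refine (sq_sum_le_card_mul_sum_sq).trans ?_
    rw [Finset.card_range]
    refine mul_le_mul hiK' ?_ (Finset.sum_nonneg fun i _ => sq_nonneg _) (by positivity)
    exact Finset.sum_le_sum_of_subset_of_nonneg (Finset.range_mono hiK)
      fun i _ _ => sq_nonneg _
  have h2 : ∑ i ∈ Finset.range (K + 1), p i * G i ^ 2 ≤ K * D := by
    calc ∑ i ∈ Finset.range (K + 1), p i * G i ^ 2
        ≤ ∑ i ∈ Finset.range (K + 1), p i * G i ^ 2 + G 0 ^ 2 :=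
          le_add_of_nonneg_right (sq_nonneg _)
      _ = ∑ i ∈ Finset.range (K + 1), p i * G i ^ 2
          - 2 * G 0 * (∑ i ∈ Finset.range (K + 1), p i * G i)
          + G 0 ^ 2 * ∑ i ∈ Finset.range (K + 1), p i := by rw [hG, hp1]; ring
      _ = ∑ i ∈ Finset.range (K + 1), p i * (G i - G 0) ^ 2 := by
          rw [Finset.mul_sum, Finset.mul_sum, ← Finset.sum_sub_distrib, ← Finset.sum_add_distrib]
          exact Finset.sum_congr rfl fun i _ => by ring
      _ ≤ ∑ i ∈ Finset.range (K + 1), p i * (K * D) :=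
          Finset.sum_le_sum fun i hi => mul_le_mul_of_nonneg_left (h1 i hi) (hp0 i).le
      _ = K * D := by rw [← Finset.sum_mul, hp1, one_mul]
  have h3 : lam * p k * D ≤ ∑ i ∈ Finset.range K, lam * p i * (G (i + 1) - G i) ^ 2 := by
    rw [hD, Finset.mul_sum]
    refine Finset.sum_le_sum fun i hi => ?_
    have := hk i (Finset.mem_range.2 ((Finset.mem_range.1 hi).trans K.lt_succ_self))
    gcongr
  refine le_trans ?_ h3
  have hpk := hp0 k
  calc lam * p k / (K + 1) * ∑ i ∈ Finset.range (K + 1), p i * G i ^ 2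
      ≤ lam * p k / (K + 1) * (K * D) := by gcongr
    _ = lam * p k * D * (K / (K + 1)) := by ring
    _ ≤ lam * p k * D * 1 := by
        gcongr
        rw [div_le_one (by positivity)]
        linarith
    _ = lam * p k * D := mul_one _

end Weight

/-! ### The generator and the semigroup -/

section Generator

variable {lam mu : ℝ} {K : ℕ}

lemma generator_mulVec (lam mu : ℝ) (K : ℕ) (G : ℕ → ℝ) (i : Fin (K + 1)) :
    (generator lam mu K *ᵥ fun j => G j) i = birthDeath lam mu K G i := by
  obtain ⟨i, hi⟩ := i
  set r : ℝ := -((if i < K then lam else 0) + (if 0 < i then mu else 0)) with hr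
  have h1 : (generator lam mu K *ᵥ fun j => G j) ⟨i, hi⟩ =
      ∑ j ∈ Finset.range (K + 1), ((if j = i + 1 then lam * G j else 0) +
        (if i = j + 1 then mu * G j else 0) + (if j = i then r * G j else 0)) := by
    rw [← Fin.sum_univ_eq_sum_range (α := ℝ) (fun j : ℕ => (if j = i + 1 then lam * G j else 0) +
        (if i = j + 1 then mu * G j else 0) + (if j = i then r * G j else 0))]
    rw [Matrix.mulVec, dotProduct]
    refine Finset.sum_congr rfl fun j _ => ?_
    simp only [generator, Matrix.of_apply, Fin.ext_iff]
    rw [← hr]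
    split_ifs <;> first | omega | ring
  rw [h1]
  simp only [Finset.sum_add_distrib, Finset.sum_ite_eq', Finset.mem_range, hi, if_true]
  cases i with
  | zero =>
    simp only [birthDeath, hr]
    simp
    split_ifs <;> ring
  | succ i =>
    simp only [Nat.add_right_cancel_iff, Finset.sum_ite_eq, Finset.mem_range, birthDeath, hr,
      Nat.succ_pos, if_true, Nat.add_sub_cancel, Nat.lt_of_succ_lt hi,
      Nat.add_lt_add_iff_right (k := 1) (n := i + 1)]
    split_ifs <;> ring

/-- Functions on `Fin (K + 1)` are restrictions of functions on `ℕ`. -/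
lemma exists_eq_comp_val (z : Fin (K + 1) → ℝ) :
    ∃ G : ℕ → ℝ, z = fun i : Fin (K + 1) => G i :=
  ⟨fun n => z (Fin.ofNat (K + 1) n), by ext i; simp⟩

lemma stationaryDist_dotProduct (lam mu : ℝ) (K : ℕ) (G : ℕ → ℝ) :
    stationaryDist lam mu K ⬝ᵥ (fun i => G i) =
      ∑ i ∈ Finset.range (K + 1), weight (lam / mu) K i * G i := by
  rw [← Fin.sum_univ_eq_sum_range (fun i => weight (lam / mu) K i * G i)]
  simp only [dotProduct, stationaryDist_eq_weight]

lemma generator_mulVec_one (lam mu : ℝ) (K : ℕ) : generator lam mu K *ᵥ 1 = 0 := by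
  ext i
  have := generator_mulVec lam mu K (fun _ => 1) i
  simp only [birthDeath, sub_self, mul_zero, ite_self, add_zero] at this
  exact this

lemma stationaryDist_vecMul_generator (hmu : 0 < mu) :
    stationaryDist lam mu K ᵥ* generator lam mu K = 0 := by
  refine dotProduct_eq_zero _ fun z => ?_
  obtain ⟨G, rfl⟩ := exists_eq_comp_val z
  rw [← Matrix.dotProduct_mulVec]
  have : (generator lam mu K *ᵥ fun i => G i) = fun i : Fin (K + 1) => birthDeath lam mu K G i :=
    funext (generator_mulVec lam mu K G)
  rw [this, stationaryDist_dotProduct]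
  exact sum_birthDeath (weight_succ hmu K) G

lemma stationaryDist_dotProduct_one (hlam : 0 < lam) (hmu : 0 < mu) :
    stationaryDist lam mu K ⬝ᵥ 1 = 1 := by
  have := stationaryDist_dotProduct lam mu K (fun _ => 1)
  simp only [mul_one, sum_weight (div_pos hlam hmu)] at this
  exact this

section Semigroup

open scoped Matrix.Norms.Operator

lemma hasDerivAt_exp_mulVec {S : Type*} [Fintype S] [DecidableEq S] (Λ : Matrix S S ℝ)
    (y : S → ℝ) (i : S) (t : ℝ) :
    HasDerivAt (fun s : ℝ => (NormedSpace.exp (s • Λ) *ᵥ y) i)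
      ((Λ *ᵥ (NormedSpace.exp (t • Λ) *ᵥ y)) i) t := by
  let L : Matrix S S ℝ →ₗ[ℝ] ℝ :=
    { toFun := fun M => (M *ᵥ y) i
      map_add' := fun M N => by simp [Matrix.add_mulVec]
      map_smul' := fun c M => by simp [Matrix.smul_mulVec] }
  have h := (L.toContinuousLinearMap.hasFDerivAt
    (x := NormedSpace.exp (t • Λ))).comp_hasDerivAt t
      (hasDerivAt_exp_smul_const' (𝕂 := ℝ) Λ t)
  rw [Matrix.mulVec_mulVec]
  exact h

lemma exp_mulVec_of_mulVec_eq_zero {S : Type*} [Fintype S] [DecidableEq S] {Λ : Matrix S S ℝ}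
    {y : S → ℝ} (h : Λ *ᵥ y = 0) (t : ℝ) : NormedSpace.exp (t • Λ) *ᵥ y = y := by
  have h1 : (t • Λ) * Matrix.replicateCol S y = 0 := by
    rw [Matrix.smul_mul, ← Matrix.replicateCol_mulVec, h, Matrix.replicateCol_zero, smul_zero]
  have h2 := exp_mul_of_mul_eq_zero h1
  rw [← Matrix.replicateCol_mulVec] at h2
  ext i
  exact congrFun (congrFun h2 i) i

end Semigroup

/-- Exponential decay in `L²` of the stationary distribution, by the Poincaré inequality. -/
lemma tendsto_exp_mulVec_of_centred (hlam : 0 < lam) (hmu : 0 < mu) {z : Fin (K + 1) → ℝ}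
    (hz : stationaryDist lam mu K ⬝ᵥ z = 0) (i : Fin (K + 1)) :
    Tendsto (fun t : ℝ => (NormedSpace.exp (t • generator lam mu K) *ᵥ z) i) atTop (𝓝 0) := by
  set Λ := generator lam mu K
  set θ := stationaryDist lam mu K
  have hp0 := weight_pos (div_pos hlam hmu) K
  have hθ0 : ∀ i, 0 < θ i := fun i => by
    simp only [θ, stationaryDist_eq_weight]; exact hp0 i
  obtain ⟨c, hc, hpoin⟩ := exists_poincare hlam hp0 (sum_weight (div_pos hlam hmu) K)
  -- Along the semigroup, the variance `F` decays at least at the rate `2 c`.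
  let Z : ℝ → Fin (K + 1) → ℝ := fun t => NormedSpace.exp (t • Λ) *ᵥ z
  let F : ℝ → ℝ := fun t => ∑ i, θ i * Z t i ^ 2
  have hZ0 : ∀ t, θ ⬝ᵥ Z t = 0 := fun t => by
    rw [Matrix.dotProduct_mulVec, vecMul_exp_of_vecMul_eq_zero
      (stationaryDist_vecMul_generator hmu), hz]
  have hF : ∀ t, HasDerivAt F (∑ i, θ i * (2 * Z t i * (Λ *ᵥ Z t) i)) t := fun t => by
    refine HasDerivAt.fun_sum fun i _ => HasDerivAt.const_mul _ ?_
    have := (hasDerivAt_exp_mulVec Λ z i t).fun_pow 2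
    rw [Nat.cast_ofNat, Nat.add_one_sub_one, pow_one] at this
    exact this
  have hdecay : ∀ t, ∑ i, θ i * (2 * Z t i * (Λ *ᵥ Z t) i) ≤ -(2 * c) * F t := fun t => by
    obtain ⟨G, hG⟩ := exists_eq_comp_val (Z t)
    have h0 := hZ0 t
    rw [hG, stationaryDist_dotProduct] at h0
    have h1 := hpoin G h0
    have h2 : F t = ∑ i ∈ Finset.range (K + 1), weight (lam / mu) K i * G i ^ 2 := by
      rw [← stationaryDist_dotProduct lam mu K (fun i => G i ^ 2)]
      simp only [F, hG]
      rfl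
    have h3 : ∑ i, θ i * (2 * Z t i * (Λ *ᵥ Z t) i) =
        2 * ∑ i ∈ Finset.range (K + 1), weight (lam / mu) K i *
          (G i * birthDeath lam mu K G i) := by
      rw [← stationaryDist_dotProduct lam mu K (fun i => G i * birthDeath lam mu K G i), hG,
        dotProduct, Finset.mul_sum]
      refine Finset.sum_congr rfl fun i _ => ?_
      rw [generator_mulVec]
      ring
    rw [h3, sum_mul_birthDeath (weight_succ hmu K), h2]
    simp only [← sq]
    linarith
  have hanti : Antitone fun t => F t * Real.exp (2 * c * t) := by
    have hd : ∀ t, HasDerivAt (fun t => F t * Real.exp (2 * c * t))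
        ((∑ i, θ i * (2 * Z t i * (Λ *ᵥ Z t) i)) * Real.exp (2 * c * t) +
          F t * (Real.exp (2 * c * t) * (2 * c))) t := fun t => by
      refine (hF t).mul ?_
      simpa using ((hasDerivAt_id t).const_mul (2 * c)).exp
    refine antitone_of_deriv_nonpos (fun t => (hd t).differentiableAt) fun t => ?_
    rw [(hd t).deriv]
    have := hdecay t
    have he := Real.exp_pos (2 * c * t)
    nlinarith
  have hFbound : ∀ t ≥ 0, F t ≤ F 0 * Real.exp (-(2 * c) * t) := fun t ht => by
    have h1 := hanti ht
    simp only [mul_zero, Real.exp_zero, mul_one] at h1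
    rw [neg_mul, Real.exp_neg, ← div_eq_mul_inv, le_div_iff₀ (Real.exp_pos _)]
    exact h1
  have hexp : Tendsto (fun t : ℝ => F 0 * Real.exp (-(2 * c) * t) / θ i) atTop (𝓝 0) := by
    have h1 : Tendsto (fun t : ℝ => Real.exp (-(2 * c) * t)) atTop (𝓝 0) :=
      Real.tendsto_exp_atBot.comp (tendsto_id.const_mul_atTop_of_neg (by linarith))
    simpa using (h1.const_mul (F 0)).div_const (θ i)
  have hsq : Tendsto (fun t => Z t i ^ 2) atTop (𝓝 0) := by
    refine squeeze_zero' (Eventually.of_forall fun t => sq_nonneg _) ?_ hexp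
    filter_upwards [eventually_ge_atTop 0] with t ht
    rw [le_div_iff₀ (hθ0 i)]
    refine le_trans ?_ (hFbound t ht)
    rw [mul_comm]
    exact Finset.single_le_sum (f := fun i => θ i * Z t i ^ 2)
      (fun j _ => mul_nonneg (hθ0 j).le (sq_nonneg _)) (Finset.mem_univ i)
  rw [tendsto_zero_iff_abs_tendsto_zero]
  have := hsq.sqrt
  simp only [Real.sqrt_sq_eq_abs, Real.sqrt_zero] at this
  exact this

/-- Convergence of the transition semigroup to equilibrium. -/
lemma tendsto_exp_mulVec (hlam : 0 < lam) (hmu : 0 < mu) (y : Fin (K + 1) → ℝ)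
    (i : Fin (K + 1)) :
    Tendsto (fun t : ℝ => (NormedSpace.exp (t • generator lam mu K) *ᵥ y) i) atTop
      (𝓝 (stationaryDist lam mu K ⬝ᵥ y)) := by
  set m := stationaryDist lam mu K ⬝ᵥ y with hm
  have hz : stationaryDist lam mu K ⬝ᵥ (y - m • 1) = 0 := by
    rw [dotProduct_sub, dotProduct_smul, stationaryDist_dotProduct_one hlam hmu, ← hm]
    simp
  have h := (tendsto_exp_mulVec_of_centred hlam hmu hz i).add_const m
  rw [zero_add] at h
  refine h.congr fun t => ?_
  rw [Matrix.mulVec_sub, Matrix.mulVec_smul,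
    exp_mulVec_of_mulVec_eq_zero (generator_mulVec_one lam mu K)]
  simp

end Generator

end MM1K

namespace MM1K

/-! ### The variance of the output process -/

section Output

variable {lam mu : ℝ} {K : ℕ}

lemma not_succ_eq_self (i : Fin (K + 1)) : ¬ (i : ℕ) + 1 = i := Nat.succ_ne_self _

/-- The rate matrix of departures shifts functions by one. -/
lemma restrictEntries_generator_mulVec (lam mu : ℝ) (K : ℕ) (G : ℕ → ℝ) (i : Fin (K + 1)) :
    (restrictEntries (fun j i : Fin (K + 1) => (i : ℕ) + 1 = j) (generator lam mu K) *ᵥ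
      fun j => G j) i = if 0 < (i : ℕ) then mu * G (i - 1) else 0 := by
  obtain ⟨i, hi⟩ := i
  have h1 : (restrictEntries (fun j i : Fin (K + 1) => (i : ℕ) + 1 = j) (generator lam mu K) *ᵥ
      fun j => G j) ⟨i, hi⟩ =
      ∑ j ∈ Finset.range (K + 1), (if i = j + 1 then mu * G j else 0) := by
    rw [← Fin.sum_univ_eq_sum_range (α := ℝ) (fun j : ℕ => if i = j + 1 then mu * G j else 0)]
    rw [Matrix.mulVec, dotProduct]
    refine Finset.sum_congr rfl fun j _ => ?_
    simp only [restrictEntries, generator, Matrix.of_apply]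
    split_ifs <;> first | omega | ring
  rw [h1]
  cases i with
  | zero => simp
  | succ i => simp [Nat.lt_of_succ_lt hi]

/-- In equilibrium, the departure rate weighs a function by `lam` times the stationary
distribution restricted to the queue lengths below `K`: each departure reverses an arrival. -/
lemma stationaryDist_dotProduct_restrictEntries (hmu : 0 < mu) (G : ℕ → ℝ) :
    (stationaryDist lam mu K ᵥ*
      restrictEntries (fun j i : Fin (K + 1) => (i : ℕ) + 1 = j) (generator lam mu K)) ⬝ᵥ
        (fun i => G i) =
      lam * (stationaryDist lam mu K ⬝ᵥ (fun i => G i) - weight (lam / mu) K K * G K) := by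
  rw [← Matrix.dotProduct_mulVec]
  have : (restrictEntries (fun j i : Fin (K + 1) => (i : ℕ) + 1 = j) (generator lam mu K) *ᵥ
      fun i => G i) = fun i : Fin (K + 1) =>
        (fun n : ℕ => if 0 < n then mu * G (n - 1) else 0) i :=
    funext (restrictEntries_generator_mulVec lam mu K G)
  rw [this, stationaryDist_dotProduct lam mu K (fun n : ℕ => if 0 < n then mu * G (n - 1) else 0),
    stationaryDist_dotProduct, Finset.sum_range_succ', Finset.sum_range_succ]
  simp only [lt_irrefl, if_false, mul_zero, add_zero, Nat.succ_pos, if_true, Nat.add_sub_cancel,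
    add_sub_cancel_right, Finset.mul_sum]
  refine Finset.sum_congr rfl fun i _ => ?_
  rw [← mul_assoc, mul_comm _ mu, weight_succ hmu]
  ring

variable {Ω : Type*}

lemma output_eq_ncard_jumpTimes (Q : ℝ≥0 → Ω → Fin (K + 1)) (t : ℝ≥0) :
    output Q t = fun ω =>
      ((jumpTimes (fun j i : Fin (K + 1) => (i : ℕ) + 1 = j) (fun s => Q s ω) 0 t).ncard : ℝ) :=
  rfl

variable [MeasurableSpace Ω] {P : Measure Ω} [IsProbabilityMeasure P]
  {Q : ℝ≥0 → Ω → Fin (K + 1)}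

lemma memLp_output (hmu : 0 < mu) (hQ : IsStationaryQueue lam mu K Q P) (t : ℝ≥0) :
    MemLp (output Q t) 2 P := by
  rw [output_eq_ncard_jumpTimes]
  rcases (zero_le : 0 ≤ t).eq_or_lt with rfl | ht
  · have : ∀ ω, jumpTimes (fun j i : Fin (K + 1) => (i : ℕ) + 1 = j) (fun s => Q s ω) 0 0 = ∅ :=
      fun ω => Set.eq_empty_of_forall_notMem fun s hs => hs.1.not_ge hs.2.1
    simp only [this, Set.ncard_empty]
    exact memLp_const _
  · exact IsMarkovChainWithGenerator.memLp_ncard_jumpTimes hQ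
      (stationaryDist_vecMul_generator hmu) not_succ_eq_self ht

/-- The linear asymptotics of the variance of the output, in terms of the centred solution `g` of
the Poisson equation for the departure rate, and of the potential `u` of a unit charge at `K`. -/
lemma tendsto_variance_output (hlam : 0 < lam) (hmu : 0 < mu)
    (hQ : IsStationaryQueue lam mu K Q P) {a : ℝ} {g u : ℕ → ℝ}
    (hg0 : ∑ i ∈ Finset.range (K + 1), weight (lam / mu) K i * g i = 0)
    (hg : ∀ i ≤ K, birthDeath lam mu K g i = (if 0 < i then mu else 0) - a)
    (hu : ∀ i ≤ K, birthDeath lam mu K u i =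
      (if i = K then (weight (lam / mu) K K)⁻¹ else 0) - 1) :
    Tendsto (fun t : ℝ≥0 => Var[output Q t; P] -
      ((a + 2 * lam * weight (lam / mu) K K * g K) * t +
        2 * lam * weight (lam / mu) K K *
          ∑ i ∈ Finset.range (K + 1), weight (lam / mu) K i * (u i * g i))) atTop (𝓝 0) := by
  set p := weight (lam / mu) K with hp
  have hp0 := weight_pos (div_pos hlam hmu) K
  obtain ⟨y, hy⟩ := exists_birthDeath_eq hlam hp0 (weight_succ hmu K) hg0
  set Λ := generator lam mu K with hΛ
  set θ := stationaryDist lam mu K with hθ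
  let yv : Fin (K + 1) → ℝ := fun i => y i
  have hΛy : Λ *ᵥ yv = fun i : Fin (K + 1) => g i := funext fun i => by
    rw [generator_mulVec, hy i (Nat.lt_succ_iff.1 i.2)]
  have hΛg : Λ *ᵥ (fun i : Fin (K + 1) => g i) =
      fun i : Fin (K + 1) => (if 0 < (i : ℕ) then mu else 0) - a := funext fun i => by
    rw [generator_mulVec, hg i (Nat.lt_succ_iff.1 i.2)]
  have hyv : restrictEntries (fun j i : Fin (K + 1) => (i : ℕ) + 1 = j) Λ *ᵥ 1 =
      a • 1 + Λ *ᵥ (Λ *ᵥ yv) := by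
    rw [hΛy, hΛg]
    ext i
    have := restrictEntries_generator_mulVec lam mu K (fun _ => 1) i
    rw [mul_one] at this
    simp only [Pi.add_apply, Pi.smul_apply, Pi.one_apply, smul_eq_mul, mul_one,
      add_sub_cancel]
    exact this
  -- Green's identity turns the value of `y` at `K`, relative to its mean, into a sum over `u`, `g`.
  have hgreen : p K * (y K - θ ⬝ᵥ yv) =
      p K * ∑ i ∈ Finset.range (K + 1), p i * (u i * g i) := by
    have h1 : ∑ i ∈ Finset.range (K + 1), p i * (u i * g i) =
        ∑ i ∈ Finset.range (K + 1), p i * (birthDeath lam mu K u i * y i) := by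
      rw [← sum_birthDeath_comm (weight_succ hmu K)]
      refine Finset.sum_congr rfl fun i hi => ?_
      rw [hy i (Nat.lt_succ_iff.1 (Finset.mem_range.1 hi))]
    have h2 : ∑ i ∈ Finset.range (K + 1), p i * (birthDeath lam mu K u i * y i) =
        ∑ i ∈ Finset.range (K + 1), ((if i = K then y i else 0) - p i * y i) := by
      refine Finset.sum_congr rfl fun i hi => ?_
      rw [hu i (Nat.lt_succ_iff.1 (Finset.mem_range.1 hi))]
      split_ifs with h
      · subst h
        have := (hp0 i).ne'
        rw [← hp] at this
        field_simp
      · ring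
    rw [h1, h2, Finset.sum_sub_distrib, Finset.sum_ite_eq', if_pos (by simp), hp,
      ← stationaryDist_dotProduct]
  have hconv : Tendsto (fun t : ℝ≥0 => 2 * lam * p K *
      (θ ⬝ᵥ yv - (NormedSpace.exp ((t : ℝ) • Λ) *ᵥ yv) (Fin.last K))) atTop (𝓝 0) := by
    have h := (tendsto_exp_mulVec hlam hmu yv (Fin.last K)).comp
      (NNReal.tendsto_coe_atTop.2 tendsto_id)
    have h' := (h.const_sub (θ ⬝ᵥ yv)).const_mul (2 * lam * p K)
    rwa [← hθ, sub_self, mul_zero] at h'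
  refine hconv.congr' ?_
  filter_upwards [eventually_gt_atTop 0] with t ht
  rw [output_eq_ncard_jumpTimes, IsMarkovChainWithGenerator.variance_ncard_jumpTimes hQ
    (stationaryDist_vecMul_generator hmu) (generator_mulVec_one lam mu K)
    (stationaryDist_dotProduct_one hlam hmu) not_succ_eq_self ht hyv, hΛy,
    stationaryDist_dotProduct_restrictEntries hmu, stationaryDist_dotProduct lam mu K g, ← hp, hg0]
  obtain ⟨E, hE⟩ := exists_eq_comp_val (NormedSpace.exp ((t : ℝ) • Λ) *ᵥ yv)
  have hEθ : θ ⬝ᵥ (fun i : Fin (K + 1) => E i) = θ ⬝ᵥ yv := by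
    rw [← hE, Matrix.dotProduct_mulVec,
      vecMul_exp_of_vecMul_eq_zero (stationaryDist_vecMul_generator hmu)]
  have h3 := stationaryDist_dotProduct_restrictEntries (lam := lam) (K := K) hmu
    (fun i => E i - y i)
  have h4 : (fun i : Fin (K + 1) => E i - y i) = (fun i : Fin (K + 1) => E i) - yv := rfl
  rw [h4, dotProduct_sub θ, hEθ, sub_self, zero_sub] at h3
  rw [← hΛ, hE, h3]
  simp only [Fin.val_last, ← hp]
  linear_combination (-2 * lam) * hgreen

end Output

end MM1K

namespace MM1K

/-! ### Explicit solutions of the Poisson equations -/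

section PowerSums

lemma sum_range_cast (n : ℕ) : ∑ i ∈ Finset.range n, (i : ℝ) = n * (n - 1) / 2 := by
  induction n with
  | zero => simp
  | succ n ih => rw [Finset.sum_range_succ, ih]; push_cast; ring

lemma sum_range_cast_sq (n : ℕ) :
    ∑ i ∈ Finset.range n, (i : ℝ) ^ 2 = n * (n - 1) * (2 * n - 1) / 6 := by
  induction n with
  | zero => simp
  | succ n ih => rw [Finset.sum_range_succ, ih]; push_cast; ring

lemma sum_range_cast_cube (n : ℕ) :
    ∑ i ∈ Finset.range n, (i : ℝ) ^ 3 = (n * (n - 1) / 2) ^ 2 := by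
  induction n with
  | zero => simp
  | succ n ih => rw [Finset.sum_range_succ, ih]; push_cast; ring

lemma sum_range_cast_pow_four (n : ℕ) :
    ∑ i ∈ Finset.range n, (i : ℝ) ^ 4 =
      n * (n - 1) * (2 * n - 1) * (3 * n ^ 2 - 3 * n - 1) / 30 := by
  induction n with
  | zero => simp
  | succ n ih => rw [Finset.sum_range_succ, ih]; push_cast; ring

variable {q : ℝ}

lemma sum_range_pow (hq : q ≠ 1) (n : ℕ) :
    ∑ i ∈ Finset.range n, q ^ i = (1 - q ^ n) / (1 - q) := by
  rw [geom_sum_eq hq, ← neg_sub, ← neg_sub 1 q, neg_div_neg_eq]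

lemma sum_range_inv_pow (hq0 : q ≠ 0) (hq : q ≠ 1) (n : ℕ) :
    ∑ i ∈ Finset.range n, (q ^ i)⁻¹ = q * ((q ^ n)⁻¹ - 1) / (1 - q) := by
  have h1 : 1 - q ≠ 0 := sub_ne_zero.2 hq.symm
  induction n with
  | zero => simp
  | succ n ih => rw [Finset.sum_range_succ, ih, pow_succ]; field_simp; ring

lemma sum_range_cast_mul_pow (hq : q ≠ 1) (n : ℕ) :
    ∑ i ∈ Finset.range n, (i : ℝ) * q ^ i =
      (q - n * q ^ n + (n - 1) * q ^ n * q) / (1 - q) ^ 2 := by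
  have h1 : 1 - q ≠ 0 := sub_ne_zero.2 hq.symm
  induction n with
  | zero => simp
  | succ n ih => rw [Finset.sum_range_succ, ih, pow_succ]; push_cast; field_simp; ring

lemma sum_range_cast_sq_mul_pow (hq : q ≠ 1) (n : ℕ) :
    ∑ i ∈ Finset.range n, (i : ℝ) ^ 2 * q ^ i =
      (q * (1 + q) - q ^ n * (n ^ 2 - (2 * n ^ 2 - 2 * n - 1) * q + (n - 1) ^ 2 * q ^ 2)) /
        (1 - q) ^ 3 := by
  have h1 : 1 - q ≠ 0 := sub_ne_zero.2 hq.symm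
  induction n with
  | zero => simp; ring_nf
  | succ n ih => rw [Finset.sum_range_succ, ih, pow_succ]; push_cast; field_simp; ring

end PowerSums

section Critical

variable {lam mu : ℝ} {K : ℕ}

lemma weight_one (K i : ℕ) : weight 1 K i = 1 / (K + 1) := by simp [weight]

/-- For `lam = mu`, the solution of the Poisson equation for the departure rate that vanishes at
`0`; its increment over `(i, i + 1)` is `(i - K) / (K + 1)`. -/
noncomputable def rateSolutionOne (K i : ℕ) : ℝ := -(K * i - i * (i - 1) / 2) / (K + 1)

/-- For `lam = mu`, the potential of a unit charge at `K`: its image under the generator is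
`1_K / π_K - 1`. -/
noncomputable def potentialOne (lam : ℝ) (i : ℕ) : ℝ := -(i * (i + 1)) / (2 * lam)

/-- For `lam = mu`, the mean of `rateSolutionOne` under the stationary distribution. -/
noncomputable def rateMeanOne (K : ℕ) : ℝ := -K * (2 * K + 1) / (6 * (K + 1))

lemma birthDeath_sub_const (lam mu : ℝ) (K : ℕ) (G : ℕ → ℝ) (c : ℝ) (i : ℕ) :
    birthDeath lam mu K (fun j => G j - c) i = birthDeath lam mu K G i := by
  simp only [birthDeath, sub_sub_sub_cancel_right]

lemma birthDeath_rateSolutionOne (lam : ℝ) (K i : ℕ) (hi : i ≤ K) :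
    birthDeath lam lam K (rateSolutionOne K) i =
      (if 0 < i then lam else 0) - lam * K / (K + 1) := by
  have hK : (K : ℝ) + 1 ≠ 0 := by positivity
  -- The increment formula vanishes at `i = K`, where the arrival term is absent.
  have hup : (if i < K then lam * (rateSolutionOne K (i + 1) - rateSolutionOne K i) else 0) =
      -lam * (K - i) / (K + 1) := by
    split_ifs with h
    · simp only [rateSolutionOne]; push_cast; field_simp; ring
    · obtain rfl : i = K := by omega
      simp
  rw [birthDeath, hup]
  cases i with
  | zero => simp; ring
  | succ i =>
    simp only [Nat.succ_pos, if_true, Nat.add_sub_cancel, rateSolutionOne]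
    push_cast; field_simp; ring

lemma birthDeath_potentialOne (hlam : 0 < lam) (K i : ℕ) (hi : i ≤ K) :
    birthDeath lam lam K (potentialOne lam) i = (if i = K then (weight 1 K K)⁻¹ else 0) - 1 := by
  have hup : (if i < K then lam * (potentialOne lam (i + 1) - potentialOne lam i) else 0) =
      (if i = K then ((i : ℝ) + 1) else 0) - (i + 1) := by
    rcases hi.lt_or_eq with h | rfl
    · rw [if_pos h, if_neg h.ne]
      simp only [potentialOne]; push_cast; field_simp; ring
    · simp
  have hdown : (if 0 < i then lam * (potentialOne lam (i - 1) - potentialOne lam i) else 0) =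
      (i : ℝ) := by
    cases i with
    | zero => simp
    | succ i =>
      simp only [Nat.succ_pos, if_true, Nat.add_sub_cancel, potentialOne]
      push_cast; field_simp; ring
  rw [birthDeath, hup, hdown, weight_one, one_div, inv_inv]
  split_ifs with h
  · rw [h]; ring
  · ring

lemma sum_weight_rateSolutionOne (K : ℕ) :
    ∑ i ∈ Finset.range (K + 1), weight 1 K i * (rateSolutionOne K i - rateMeanOne K) = 0 := by
  have hK : (K : ℝ) + 1 ≠ 0 := by positivity
  have h : ∀ i : ℕ, weight 1 K i * (rateSolutionOne K i - rateMeanOne K) =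
      1 / (2 * (K + 1) ^ 2) * (i : ℝ) ^ 2 - (2 * K + 1) / (2 * (K + 1) ^ 2) * i
        - 1 / (K + 1) * rateMeanOne K := fun i => by
    rw [weight_one, rateSolutionOne]; field_simp; ring
  rw [Finset.sum_congr rfl fun i _ => h i]
  simp only [Finset.sum_sub_distrib, ← Finset.mul_sum, sum_range_cast, sum_range_cast_sq,
    Finset.sum_const, Finset.card_range, nsmul_eq_mul]
  rw [rateMeanOne]
  push_cast; field_simp; ring

lemma rate_critical (lam : ℝ) (K : ℕ) :
    lam * K / (K + 1) + 2 * lam * weight 1 K K * (rateSolutionOne K K - rateMeanOne K) =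
      lam * (2 / 3 - (3 * (K : ℝ) + 2) / (3 * ((K : ℝ) + 1) ^ 2)) := by
  have hK : (K : ℝ) + 1 ≠ 0 := by positivity
  rw [weight_one, rateSolutionOne, rateMeanOne]
  field_simp
  ring

lemma intercept_critical (hlam : 0 < lam) (K : ℕ) :
    2 * lam * weight 1 K K * ∑ i ∈ Finset.range (K + 1),
        weight 1 K i * (potentialOne lam i * (rateSolutionOne K i - rateMeanOne K)) =
      (7 * (K : ℝ) ^ 4 + 28 * (K : ℝ) ^ 3 + 37 * (K : ℝ) ^ 2 + 18 * (K : ℝ)) /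
            (180 * ((K : ℝ) + 1) ^ 2) := by
  have hK : (K : ℝ) + 1 ≠ 0 := by positivity
  have h : ∀ i : ℕ, weight 1 K i * (potentialOne lam i * (rateSolutionOne K i - rateMeanOne K)) =
      1 / (4 * lam * (K + 1) ^ 2) * (-(i : ℝ) ^ 4 + 2 * K * (i : ℝ) ^ 3 + (2 * K + 1) * (i : ℝ) ^ 2
        + 2 * (K + 1) * rateMeanOne K * (i : ℝ) ^ 2
        + 2 * (K + 1) * rateMeanOne K * (i : ℝ)) := fun i => by
    rw [weight_one, rateSolutionOne, potentialOne]; field_simp; ring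
  rw [Finset.sum_congr rfl fun i _ => h i]
  simp only [Finset.sum_add_distrib, Finset.sum_neg_distrib, ← Finset.mul_sum, sum_range_cast,
    sum_range_cast_sq, sum_range_cast_cube, sum_range_cast_pow_four]
  rw [weight_one, rateMeanOne]
  push_cast; field_simp; ring

end Critical

section NonCritical

variable {lam mu rho : ℝ} {K : ℕ}

lemma weight_of_ne_one (hrho : rho ≠ 1) (K i : ℕ) :
    weight rho K i = (1 - rho) * rho ^ i / (1 - rho * rho ^ K) := by
  rw [weight, sum_range_pow hrho, pow_succ', div_div_eq_mul_div, mul_comm]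

lemma one_sub_pow_ne_zero (h0 : 0 < rho) (hrho : rho ≠ 1) (K : ℕ) : 1 - rho * rho ^ K ≠ 0 := by
  rw [← pow_succ', sub_ne_zero]
  exact fun h => hrho ((pow_eq_one_iff_of_nonneg h0.le K.succ_ne_zero).1 h.symm)

/-- For `rho = lam / mu ≠ 1`, the solution of the Poisson equation for the departure rate that
vanishes at `0`; its increment over `(i, i + 1)` is `(rho ^ (K - i) - 1) / (1 - rho ^ (K + 1))`. -/
noncomputable def rateSolution (rho : ℝ) (K i : ℕ) : ℝ :=
  (rho * rho ^ K * ((rho ^ i)⁻¹ - 1) / (1 - rho) - i) / (1 - rho * rho ^ K)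

/-- For `rho = lam / mu ≠ 1`, the potential of a unit charge at `K`: its image under the generator is
`1_K / π_K - 1`. -/
noncomputable def potential (lam rho : ℝ) (i : ℕ) : ℝ :=
  -(rho * ((rho ^ i)⁻¹ - 1) / (1 - rho) - rho * i) / (lam * (1 - rho))

/-- For `rho ≠ 1`, the mean of `rateSolution` under the stationary distribution. -/
noncomputable def rateMean (rho : ℝ) (K : ℕ) : ℝ :=
  ((K + 1) * (rho * rho ^ K) * (2 - rho) - K * (rho * rho ^ K) * rho - rho -
    rho * rho ^ K * (1 - rho * rho ^ K)) / ((1 - rho) * (1 - rho * rho ^ K) ^ 2)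

lemma birthDeath_rateSolution (hmu : 0 < mu) (h0 : 0 < rho) (hrho : rho ≠ 1)
    (hlam : lam = rho * mu) (K i : ℕ) (hi : i ≤ K) :
    birthDeath lam mu K (rateSolution rho K) i =
      (if 0 < i then mu else 0) - lam * (1 - rho ^ K) / (1 - rho * rho ^ K) := by
  have hZ := one_sub_pow_ne_zero h0 hrho K
  have h1 : 1 - rho ≠ 0 := sub_ne_zero.2 hrho.symm
  -- The increment formula vanishes at `i = K`, where the arrival term is absent.
  have hup : (if i < K then lam * (rateSolution rho K (i + 1) - rateSolution rho K i) else 0) =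
      lam * (rho ^ K * (rho ^ i)⁻¹ - 1) / (1 - rho * rho ^ K) := by
    split_ifs with h
    · simp only [rateSolution, pow_succ]; push_cast; field_simp; ring
    · obtain rfl : i = K := by omega
      rw [mul_inv_cancel₀ (pow_pos h0 i).ne']; simp
  rw [birthDeath, hup, hlam]
  cases i with
  | zero => simp; field_simp; ring
  | succ i =>
    simp only [Nat.succ_pos, if_true, Nat.add_sub_cancel, rateSolution, pow_succ]
    push_cast; field_simp; ring

lemma birthDeath_potential (hmu : 0 < mu) (h0 : 0 < rho) (hrho : rho ≠ 1)
    (hlam : lam = rho * mu) (K i : ℕ) (hi : i ≤ K) :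
    birthDeath lam mu K (potential lam rho) i =
      (if i = K then (weight rho K K)⁻¹ else 0) - 1 := by
  have hZ := one_sub_pow_ne_zero h0 hrho K
  have h1 : 1 - rho ≠ 0 := sub_ne_zero.2 hrho.symm
  have hlam0 : lam ≠ 0 := by rw [hlam]; positivity
  have hup : (if i < K then lam * (potential lam rho (i + 1) - potential lam rho i) else 0) =
      (if i = K then ((rho ^ i)⁻¹ - rho) / (1 - rho) else 0) - ((rho ^ i)⁻¹ - rho) / (1 - rho) := by
    rcases hi.lt_or_eq with h | rfl
    · rw [if_pos h, if_neg h.ne]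
      simp only [potential, pow_succ]; push_cast; field_simp; ring
    · simp
  have hdown : (if 0 < i then mu * (potential lam rho (i - 1) - potential lam rho i) else 0) =
      ((rho ^ i)⁻¹ - 1) / (1 - rho) := by
    cases i with
    | zero => simp
    | succ i =>
      simp only [Nat.succ_pos, if_true, Nat.add_sub_cancel, potential, pow_succ, hlam]
      push_cast; field_simp; ring
  rw [birthDeath, hup, hdown, weight_of_ne_one hrho]
  split_ifs with h
  · rw [h]; field_simp; ring
  · field_simp; ring

lemma sum_weight_rateSolution (h0 : 0 < rho) (hrho : rho ≠ 1) (K : ℕ) :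
    ∑ i ∈ Finset.range (K + 1), weight rho K i * (rateSolution rho K i - rateMean rho K) = 0 := by
  have hZ := one_sub_pow_ne_zero h0 hrho K
  have h1 : 1 - rho ≠ 0 := sub_ne_zero.2 hrho.symm
  have h : ∀ i : ℕ, weight rho K i * (rateSolution rho K i - rateMean rho K) =
      (1 - rho) / (1 - rho * rho ^ K) ^ 2 *
        (rho * rho ^ K / (1 - rho) - rho * rho ^ K / (1 - rho) * rho ^ i - i * rho ^ i -
          (1 - rho * rho ^ K) * rateMean rho K * rho ^ i) := fun i => by
    rw [weight_of_ne_one hrho, rateSolution]; field_simp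
  rw [Finset.sum_congr rfl fun i _ => h i]
  simp only [Finset.sum_sub_distrib, ← Finset.mul_sum, sum_range_pow hrho,
    sum_range_cast_mul_pow hrho, Finset.sum_const, Finset.card_range, nsmul_eq_mul]
  rw [rateMean, pow_succ']
  push_cast; field_simp; ring

lemma rate_nonCritical (h0 : 0 < rho) (hrho : rho ≠ 1) (lam : ℝ) (K : ℕ) :
    lam * (1 - rho ^ K) / (1 - rho * rho ^ K) +
        2 * lam * weight rho K K * (rateSolution rho K K - rateMean rho K) =
      lam * (((1 + rho ^ (K + 1)) *
              (1 - (1 + 2 * (K : ℝ)) * rho ^ K * (1 - rho) - rho ^ (2 * K + 1))) /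
            (1 - rho ^ (K + 1)) ^ 3) := by
  have hZ := one_sub_pow_ne_zero h0 hrho K
  have h1 : 1 - rho ≠ 0 := sub_ne_zero.2 hrho.symm
  rw [weight_of_ne_one hrho, rateSolution, rateMean, pow_succ' rho K, pow_succ' rho (2 * K),
    two_mul K, pow_add]
  have hX := (pow_pos h0 K).ne'
  generalize rho ^ K = X at *
  field_simp
  ring

lemma intercept_nonCritical (hlam : 0 < lam) (h0 : 0 < rho) (hrho : rho ≠ 1) (K : ℕ) :
    2 * lam * weight rho K K * ∑ i ∈ Finset.range (K + 1),
        weight rho K i * (potential lam rho i * (rateSolution rho K i - rateMean rho K)) =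
      rho ^ (K + 1) *
            (((6 * (1 + rho ^ 2) * (1 + (K : ℝ)) ^ 2
                  - 4 * rho * (1 + 6 * (K : ℝ) + 3 * (K : ℝ) ^ 2)) * rho ^ (K + 1)
                + rho ^ 2 * (2 + 3 * (K : ℝ) + (K : ℝ) ^ 2) * (1 + rho ^ (2 * K))) /
              ((1 - rho) ^ 2 * (1 - rho ^ (K + 1)) ^ 4)
            - (2 * rho * (3 + 2 * (K : ℝ) + (K : ℝ) ^ 2) * (1 + rho ^ (2 * (K + 1)))
                - (K : ℝ) * (1 + (K : ℝ)) * (1 + rho ^ (2 * (K + 2)))) /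
              ((1 - rho) ^ 2 * (1 - rho ^ (K + 1)) ^ 4)) := by
  have hZ := one_sub_pow_ne_zero h0 hrho K
  have h1 : 1 - rho ≠ 0 := sub_ne_zero.2 hrho.symm
  have h : ∀ i : ℕ, weight rho K i *
      (potential lam rho i * (rateSolution rho K i - rateMean rho K)) =
      -rho / (lam * (1 - rho) * (1 - rho * rho ^ K) ^ 2) *
        (rho * rho ^ K / (1 - rho) * (rho ^ i)⁻¹
          - (2 * (rho * rho ^ K) / (1 - rho) + (1 - rho * rho ^ K) * rateMean rho K)
          - (1 + rho * rho ^ K) * i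
          + (rho * rho ^ K / (1 - rho) + (1 - rho * rho ^ K) * rateMean rho K) * rho ^ i
          + (1 + rho * rho ^ K + (1 - rho) * (1 - rho * rho ^ K) * rateMean rho K) *
              (i * rho ^ i)
          + (1 - rho) * (i ^ 2 * rho ^ i)) := fun i => by
    rw [weight_of_ne_one hrho, rateSolution, potential]
    field_simp
    ring
  rw [Finset.sum_congr rfl fun i _ => h i]
  simp only [Finset.sum_sub_distrib, Finset.sum_add_distrib, ← Finset.mul_sum,
    sum_range_pow hrho, sum_range_inv_pow h0.ne' hrho, sum_range_cast,
    sum_range_cast_mul_pow hrho, sum_range_cast_sq_mul_pow hrho, Finset.sum_const,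
    Finset.card_range, nsmul_eq_mul]
  rw [weight_of_ne_one hrho, rateMean, pow_succ' rho K]
  rw [mul_add 2 K 1, mul_add 2 K 2, pow_add, pow_add, two_mul K, pow_add]
  have hX := (pow_pos h0 K).ne'
  generalize rho ^ K = X at *
  push_cast
  field_simp
  ring

end NonCritical

end MM1K

/-! ### The asymptotic variance -/

theorem mainTheorem2 {Ω : Type*} [MeasurableSpace Ω] (P : Measure Ω) [IsProbabilityMeasure P]
    (lam mu rho : ℝ) (hlam : 0 < lam) (hmu : 0 < mu) (hrho : rho = lam / mu) (K : ℕ)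
    (Q : ℝ≥0 → Ω → Fin (K + 1)) (hQ : MM1K.IsStationaryQueue lam mu K Q P) :
    (∀ t : ℝ≥0, MemLp (MM1K.output Q t) 2 P) ∧
    (rho ≠ 1 →
      (fun t : ℝ≥0 => Var[MM1K.output Q t; P] -
        (lam * (((1 + rho ^ (K + 1)) *
              (1 - (1 + 2 * (K : ℝ)) * rho ^ K * (1 - rho) - rho ^ (2 * K + 1))) /
            (1 - rho ^ (K + 1)) ^ 3) * (t : ℝ) +
          rho ^ (K + 1) *
            (((6 * (1 + rho ^ 2) * (1 + (K : ℝ)) ^ 2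
                  - 4 * rho * (1 + 6 * (K : ℝ) + 3 * (K : ℝ) ^ 2)) * rho ^ (K + 1)
                + rho ^ 2 * (2 + 3 * (K : ℝ) + (K : ℝ) ^ 2) * (1 + rho ^ (2 * K))) /
              ((1 - rho) ^ 2 * (1 - rho ^ (K + 1)) ^ 4)
            - (2 * rho * (3 + 2 * (K : ℝ) + (K : ℝ) ^ 2) * (1 + rho ^ (2 * (K + 1)))
                - (K : ℝ) * (1 + (K : ℝ)) * (1 + rho ^ (2 * (K + 2)))) /
              ((1 - rho) ^ 2 * (1 - rho ^ (K + 1)) ^ 4))))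
        =o[atTop] (fun _ => (1 : ℝ))) ∧
    (rho = 1 →
      (fun t : ℝ≥0 => Var[MM1K.output Q t; P] -
        (lam * (2 / 3 - (3 * (K : ℝ) + 2) / (3 * ((K : ℝ) + 1) ^ 2)) * (t : ℝ) +
          (7 * (K : ℝ) ^ 4 + 28 * (K : ℝ) ^ 3 + 37 * (K : ℝ) ^ 2 + 18 * (K : ℝ)) /
            (180 * ((K : ℝ) + 1) ^ 2)))
        =o[atTop] (fun _ => (1 : ℝ))) := by
  refine ⟨MM1K.memLp_output hmu hQ, fun hne => ?_, fun heq => ?_⟩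
  · have h0 : 0 < lam / mu := div_pos hlam hmu
    rw [hrho] at hne
    have hl : lam = lam / mu * mu := (div_mul_cancel₀ _ hmu.ne').symm
    have h := MM1K.tendsto_variance_output hlam hmu hQ
      (MM1K.sum_weight_rateSolution h0 hne K)
      (fun i hi => (MM1K.birthDeath_sub_const lam mu K _ _ i).trans
        (MM1K.birthDeath_rateSolution hmu h0 hne hl K i hi))
      (MM1K.birthDeath_potential hmu h0 hne hl K)
    rw [MM1K.rate_nonCritical h0 hne, MM1K.intercept_nonCritical hlam h0 hne] at h
    rw [isLittleO_one_iff, hrho]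
    exact h
  · rw [hrho] at heq
    obtain rfl : lam = mu := (div_eq_one_iff_eq hmu.ne').1 heq
    have h := MM1K.tendsto_variance_output hlam hmu hQ (a := lam * K / (K + 1))
      (g := fun i => MM1K.rateSolutionOne K i - MM1K.rateMeanOne K)
      (u := MM1K.potentialOne lam)
      (by rw [heq]; exact MM1K.sum_weight_rateSolutionOne K)
      (fun i hi => (MM1K.birthDeath_sub_const lam lam K _ _ i).trans
        (MM1K.birthDeath_rateSolutionOne lam K i hi))
      (by rw [heq]; exact MM1K.birthDeath_potentialOne hlam K)
    rw [heq, MM1K.rate_critical, MM1K.intercept_critical hlam] at h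
    rw [isLittleO_one_iff]
    exact h
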